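/- Consider a discounted constrained Markov decision process (CMDP) with finite state space $S$, finite action space $A$, transition kernel $P$, reward $r\colon S\times A\to[0,1]$, constraint rewards $c_1,\dots,c_d\colon S\times A\to[0,1]$ ($d\ge 1$), levels $b\in\mathbb R^d$, initial distribution $\rho$ and discount factor $\gamma\in[0,1)$. For a stationary randomized policy $\pi$ let $V_l^\pi(\rho)=\mathbb E\big[\sum_{t\ge 0}\gamma^t l(s_t,a_t)\big]$ with $s_0\sim\rho$, $a_t\sim\pi(\cdot|s_t)$, $s_{t+1}\sim P(\cdot|s_t,a_t)$. Assume that some stationary policy is feasible, i.e. satisfies $V_{c_i}^\pi(\rho)\ge b_i$ for all $i$, and let $V_r^*(\rho)$ be the supremum of $V_r^\pi(\rho)$ over all feasible stationary policies. The algorithm does not know $P$. With inputs $N$, $b'$, $\omega$, $U$, $\varepsilon_1$, $T$ it draws, for every $(s,a)$, $N$ independent samples from $P(\cdot|s,a)$ and forms the empirical kernel $\hat P$; it draws independent perturbations $\xi(s,a)$ uniform on $[0,\omega]$, also independent of the samples, and sets $r_p=r+\xi$. It starts from $\lambda_0=0\in\mathbb R^d$. For $t=0,\dots,T-1$ it takes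 as $\hat\pi_t$ any stationary policy that is optimal, from every initial state, for the unconstrained MDP with kernel $\hat P$ and reward $r_p+\sum_i\lambda_{t,i}c_i$. It then obtains $\lambda_{t+1,i}$ by projecting $\lambda_{t,i}-\eta\big(\hat V_{c_i}^{\hat\pi_t}(\rho)-b_i'\big)$ onto $[0,U]$ and rounding the result to a closest point of the net $\{0,\varepsilon_1,2\varepsilon_1,\dots,U\}$, where $\hat V$ denotes values under $\hat P$ and $\eta=U(1-\gamma)/\sqrt T$. Ties may be broken in any way. It returns the mixture policy $\bar\pi_T=\frac1T\sum_{t<T}\hat\pi_t$, which draws $t$ uniformly once and then follows $\hat\pi_t$, so that $V_l^{\bar\pi_T}(\rho)=\frac1T\sum_{t<T}V_l^{\hat\pi_t}(\rho)$. **Theorem.** There are absolute constants $C$ and $k$ such that the following holds for all $d\ge1$, $\gamma\in[0,1)$ and $\varepsilon\in(0,\frac1{1-\gamma}]$. There are $U>0$, $\varepsilon_1>0$ and an integer $T\ge 1$, depending only on $d,\gamma,\varepsilon$, with $$U\le\frac{C}{\varepsilon(1-\gamma)},\qquad \varepsilon_1\le C\varepsilon^2(1-\gamma)^2,\qquad T\le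 \frac{C\,d^2}{(1-\gamma)^4\varepsilon^4},$$ such that for all $\delta\in(0,1)$ and all finite nonempty $S,A$ there is $N_0$, not depending on the CMDP, with $$N_0\le C\,L^k\,\frac{d\log(1/\delta)}{(1-\gamma)^3\varepsilon^2},\qquad L=1+\log\frac{d|S||A|}{\varepsilon(1-\gamma)^2},$$ so that $N_0$ samples per state-action pair are at most $C\,L^k\,\frac{d|S||A|\log(1/\delta)}{(1-\gamma)^3\varepsilon^2}$ samples in total, and with the following property. For every $N\ge N_0$ and every CMDP as above with a feasible policy, the algorithm with $b_i'=b_i-\frac{3\varepsilon}{8}$ and $\omega=\frac{\varepsilon(1-\gamma)}{8}$ can be executed and, whatever the tie-breaking, returns with probability at least $1-3\delta$ a mixture policy with $$V_r^{\bar\pi_T}(\rho)\ge V_r^*(\rho)-\varepsilon\qquad\text{and}\qquad V_{c_i}^{\bar\pi_T}(\rho)\ge b_i-\varepsilon\quad\text{for all } i=1,\dots,d.$$ -/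

import Mathlib

open MeasureTheory

universe u v

noncomputable section

/-- A stationary (randomized) policy: `π s a` is the probability of playing `a` in state `s`. -/
def IsPolicy {S A : Type*} [Fintype A] (π : S → A → ℝ) : Prop :=
  ∀ s, π s ∈ stdSimplex ℝ A

/-- `expectedReward P π l t s` is `𝔼[l (s_t, a_t) | s_0 = s]` for the chain in which
`a_t ∼ π(·|s_t)` and `s_{t+1} ∼ P(·|s_t, a_t)`, computed by conditioning on the first step. -/
def expectedReward {S A : Type*} [Fintype S] [Fintype A]
    (P : S → A → S → ℝ) (π : S → A → ℝ) (l : S → A → ℝ) : ℕ → S → ℝ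
  | 0, s => ∑ a, π s a * l s a
  | t + 1, s => ∑ a, π s a * ∑ s', P s a s' * expectedReward P π l t s'

/-- The value `V_l^π(s)`: expected discounted sum of `l` along the chain started in `s`. -/
def stateValue {S A : Type*} [Fintype S] [Fintype A] (γ : ℝ)
    (P : S → A → S → ℝ) (l : S → A → ℝ) (π : S → A → ℝ) (s : S) : ℝ :=
  ∑' t : ℕ, γ ^ t * expectedReward P π l t s

/-- The value `V_l^π(ρ)`, with the initial state drawn from `ρ`. -/
def value {S A : Type*} [Fintype S] [Fintype A] (γ : ℝ) (ρ : S → ℝ)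
    (P : S → A → S → ℝ) (l : S → A → ℝ) (π : S → A → ℝ) : ℝ :=
  ∑ s, ρ s * stateValue γ P l π s

/-- `π` solves the unconstrained MDP with transitions `P` and reward `l`: it is a stationary
policy whose value is maximal, among all stationary policies, from every initial state. -/
def IsOptimalPolicy {S A : Type*} [Fintype S] [Fintype A] (γ : ℝ)
    (P : S → A → S → ℝ) (l : S → A → ℝ) (π : S → A → ℝ) : Prop :=
  IsPolicy π ∧ ∀ π', IsPolicy π' → ∀ s, stateValue γ P l π' s ≤ stateValue γ P l π s

/-- A discounted constrained MDP with finitely many states and actions, discount factor `γ`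
and `d` constraints `V_{c_i}^π(ρ) ≥ b_i`. -/
structure CMDP (S A : Type*) [Fintype S] [Fintype A] (d : ℕ) where
  /-- transition probabilities, `P s a s' = P(s' | s, a)` -/
  P : S → A → S → ℝ
  P_mem : ∀ s a, P s a ∈ stdSimplex ℝ S
  /-- reward -/
  r : S → A → ℝ
  r_mem : ∀ s a, r s a ∈ Set.Icc (0 : ℝ) 1
  /-- constraint rewards -/
  c : Fin d → S → A → ℝ
  c_mem : ∀ i s a, c i s a ∈ Set.Icc (0 : ℝ) 1
  /-- constraint levels -/
  b : Fin d → ℝ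
  /-- initial distribution -/
  ρ : S → ℝ
  ρ_mem : ρ ∈ stdSimplex ℝ S
  /-- discount factor -/
  γ : ℝ
  γ_mem : γ ∈ Set.Ico (0 : ℝ) 1

namespace CMDP

variable {S A : Type*} [Fintype S] [Fintype A] {d : ℕ}

/-- A feasible policy of the constrained problem. -/
def IsFeasible (M : CMDP S A d) (π : S → A → ℝ) : Prop :=
  IsPolicy π ∧ ∀ i, M.b i ≤ value M.γ M.ρ M.P (M.c i) π

/-- The optimal value `V_r^*(ρ)` of the constrained problem. -/
def optimalValue (M : CMDP S A d) : ℝ :=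
  sSup {x | ∃ π, M.IsFeasible π ∧ x = value M.γ M.ρ M.P M.r π}

end CMDP

/-- The random data of the algorithm: `N` next states for every state-action pair, and one
reward perturbation for every state-action pair. -/
abbrev Data (S A : Type*) (N : ℕ) : Type _ :=
  (S × A × Fin N → S) × (S × A → ℝ)

/-- The measure on the finite set `S` with weights `p`. -/
def weightMeasure {S : Type*} [Fintype S] [MeasurableSpace S] (p : S → ℝ) : Measure S :=
  ∑ s, ENNReal.ofReal (p s) • Measure.dirac s

/-- The law of the data: all samples and perturbations are independent, the samples for `(s, a)`
have law `P(·|s, a)`, and the perturbations are uniform on `[0, ω]`. -/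
def CMDP.dataLaw {S A : Type*} [Fintype S] [MeasurableSpace S] [Fintype A] {d : ℕ}
    (M : CMDP S A d) (N : ℕ) (ω : ℝ) : Measure (Data S A N) :=
  (Measure.pi fun q : S × A × Fin N => weightMeasure (M.P q.1 q.2.1)).prod
    (Measure.pi fun _ : S × A => ProbabilityTheory.cond volume (Set.Icc 0 ω))

open Classical in
/-- The empirical transition probabilities `N(s' | s, a) / N`. -/
def empiricalP {S A : Type*} {N : ℕ} (D : Data S A N) (s : S) (a : A) (s' : S) : ℝ :=
  ((Finset.univ.filter fun j : Fin N => D.1 (s, a, j) = s').card : ℝ) / N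

/-- The perturbed reward `r_p = r + ξ`. -/
def perturbedReward {S A : Type*} {N : ℕ} (r : S → A → ℝ) (D : Data S A N) (s : S) (a : A) : ℝ :=
  r s a + D.2 (s, a)

/-- The net `{0, ε₁, 2ε₁, …, U}`. -/
def dualNet (ε₁ U : ℝ) : Set ℝ :=
  {x | (∃ k : ℕ, x = k * ε₁) ∧ x ≤ U} ∪ {U}

/-- `y` is a closest element of `Λ` to `x`. -/
def IsRounding (Λ : Set ℝ) (x y : ℝ) : Prop :=
  y ∈ Λ ∧ ∀ z ∈ Λ, |x - y| ≤ |x - z|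

/-- `lam` and `pol` are the dual and primal iterates of a run of the model-based primal-dual
algorithm on the data `D`, with constraint levels `b'`, projection bound `U`, net resolution `ε₁`,
step size `η` and `T` iterations. Of the CMDP, the algorithm uses only the known parts
`r, c, ρ, γ`; the transition probabilities enter through the data alone. -/
structure CMDP.IsRun {S A : Type*} [Fintype S] [Fintype A] {d N : ℕ} (M : CMDP S A d)
    (D : Data S A N) (b' : Fin d → ℝ) (U ε₁ η : ℝ) (T : ℕ)
    (lam : ℕ → Fin d → ℝ) (pol : ℕ → S → A → ℝ) : Prop where
  init : lam 0 = 0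
  primal : ∀ t < T, IsOptimalPolicy M.γ (empiricalP D)
    (fun s a => perturbedReward M.r D s a + ∑ i, lam t i * M.c i s a) (pol t)
  dual : ∀ t < T, ∀ i, IsRounding (dualNet ε₁ U)
    (max 0 (min U (lam t i - η * (value M.γ M.ρ (empiricalP D) (M.c i) (pol t) - b' i))))
    (lam (t + 1) i)

/-- The value in the true CMDP of the mixture `(1/T) ∑_{t<T} π_t`, which draws `t` uniformly once
and then follows `π_t` forever. -/
def CMDP.mixtureValue {S A : Type*} [Fintype S] [Fintype A] {d : ℕ} (M : CMDP S A d)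
    (l : S → A → ℝ) (T : ℕ) (pol : ℕ → S → A → ℝ) : ℝ :=
  (1 / (T : ℝ)) * ∑ t ∈ Finset.range T, value M.γ M.ρ M.P l (pol t)

end

/-!
The argument combines a primal-dual analysis on the empirical problem with an evaluation of the
computed policies under the true kernel. Write `a = 1 - γ`.

**Evaluation.** Let `V` be the value of a policy under the empirical kernel. If in every row the
error `|(P̂ - P) V|` is at most a small multiple `≈ a² ε` of `Var_P V`, plus a constant `≈ a ε`, then
`V` is within `ε / 8` of the true value (`abs_stateValue_sub_le`). This uses that the one-step
variances along the chain accumulate to `O(a⁻²)` only (`stateValue_weightVar_le`); the remaining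
accumulated error is absorbed, so that all `ε ≤ 1 / a` are covered. Bernstein's inequality provides
such bounds, for a vector independent of the row, from `N ≈ a⁻³ ε⁻²` samples
(`measure_not_concentrated_le`).

**Decoupling.** The computed policies depend on all rows. For a given row `(s₀, a₀)`, stop the
process when `a₀` is played in `s₀` and pay a final reward `q`. With `q` equal to the action value at
`(s₀, a₀)` nothing changes, and the values are Lipschitz in `q`; hence nets of final rewards suffice,
and the stopped values are independent of the row. Values of a fixed policy survive the
discretization (`abs_stateValue_sub_le_of_rowConcentrated`). The optimal policy survives it if in
every state the best action is better than the others by some gap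
(`IsOptimalPolicy.eq_greedy_stopAt`), and the random perturbation of the rewards creates such a gap:
raising the reward of an optimal pair opens its gap at rate at least `a`
(`sub_le_of_mem_gapFailure`). The gap and the nets enter the sample size only logarithmically. The
union bound over all multipliers in the net contributes the factor `d`
(`exists_accurateData_event`, `union_budget`).

**Primal-dual iteration.** Summing the optimality of the iterates for the Lagrangian and the regret of
projected gradient descent for the multipliers gives `CMDP.IsRun.sum_gap_le`. The multipliers of
constraints with nonpositive level remain zero, so that levels far below zero do no harm. With
`U ≈ 1 / (ε a)` a constraint violation is more expensive than the whole range of the reward values,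
which yields `CMDP.IsRun.mixtureValue_ge` on accurate data.
-/

set_option linter.unusedSectionVars false

noncomputable section

/-! ### Substochastic kernels and the comparison principle -/

/-- A nonnegative kernel whose rows sum to at most `1`. Rows of total mass less than `1` describe a
chain that may stop; stochastic kernels are the special case used by the CMDP itself. -/
structure IsSubKernel {S A : Type*} [Fintype S] (K : S → A → S → ℝ) : Prop where
  nonneg : ∀ s a s', 0 ≤ K s a s'
  sum_le_one : ∀ s a, ∑ s', K s a s' ≤ 1

/-- The right-hand side of the Bellman equation: reward `R` at `(s, a)`, then the discounted `V` at
the next state. -/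
def qValue {S A : Type*} [Fintype S] (γ : ℝ) (K : S → A → S → ℝ) (R : S → A → ℝ) (V : S → ℝ)
    (s : S) (a : A) : ℝ :=
  R s a + γ * ∑ s', K s a s' * V s'

/-- The deterministic policy that plays `m s` in state `s`. -/
def detPolicy {S A : Type*} (m : S → A) (s : S) (a : A) : ℝ :=
  open Classical in if a = m s then 1 else 0

section Values

variable {S A : Type*} [Fintype S] [Fintype A] {γ : ℝ} {K : S → A → S → ℝ} {π : S → A → ℝ}

theorem isSubKernel_of_mem_stdSimplex (hK : ∀ s a, K s a ∈ stdSimplex ℝ S) : IsSubKernel K :=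
  ⟨fun s a s' => (hK s a).1 s', fun s a => (hK s a).2.le⟩

theorem sum_detPolicy_mul (m : S → A) (s : S) (f : A → ℝ) :
    ∑ a, detPolicy m s a * f a = f (m s) := by
  classical
  simp [detPolicy]

theorem isPolicy_detPolicy (m : S → A) : IsPolicy (detPolicy m) := by
  classical
  refine fun s => ⟨fun a => ?_, ?_⟩
  · by_cases h : a = m s <;> simp [detPolicy, h]
  · simpa using sum_detPolicy_mul m s fun _ => 1

theorem exists_le_of_le_sum_mul {p : A → ℝ} (hp : p ∈ stdSimplex ℝ A) {f : A → ℝ} {x : ℝ}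
    (h : x ≤ ∑ a, p a * f a) : ∃ a, x ≤ f a := by
  by_contra! hlt
  obtain ⟨a, ha⟩ : ∃ a, 0 < p a := by
    by_contra! hle
    have := Finset.sum_nonpos fun a (_ : a ∈ Finset.univ) => hle a
    linarith [hp.2]
  have : ∑ a, p a * f a < ∑ a, p a * x :=
    Finset.sum_lt_sum (fun b _ => mul_le_mul_of_nonneg_left (hlt b).le (hp.1 b))
      ⟨a, Finset.mem_univ a, mul_lt_mul_of_pos_left (hlt a) ha⟩
  rw [← Finset.sum_mul, hp.2, one_mul] at this
  linarith

theorem sum_mul_le_of_le {p : A → ℝ} (hp : p ∈ stdSimplex ℝ A) {f : A → ℝ} {x : ℝ}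
    (h : ∀ a, f a ≤ x) : ∑ a, p a * f a ≤ x := by
  calc ∑ a, p a * f a ≤ ∑ a, p a * x :=
        Finset.sum_le_sum fun a _ => mul_le_mul_of_nonneg_left (h a) (hp.1 a)
    _ = x := by rw [← Finset.sum_mul, hp.2, one_mul]

theorem le_sum_mul_of_le {p : A → ℝ} (hp : p ∈ stdSimplex ℝ A) {f : A → ℝ} {x : ℝ}
    (h : ∀ a, x ≤ f a) : x ≤ ∑ a, p a * f a := by
  calc x = ∑ a, p a * x := by rw [← Finset.sum_mul, hp.2, one_mul]
    _ ≤ ∑ a, p a * f a :=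
        Finset.sum_le_sum fun a _ => mul_le_mul_of_nonneg_left (h a) (hp.1 a)

theorem IsSubKernel.sum_mul_le (hK : IsSubKernel K) {f : S → ℝ} {M : ℝ} (hM : 0 ≤ M)
    (hf : ∀ s, f s ≤ M) (s : S) (a : A) : ∑ s', K s a s' * f s' ≤ M := by
  calc ∑ s', K s a s' * f s' ≤ ∑ s', K s a s' * M :=
        Finset.sum_le_sum fun s' _ => mul_le_mul_of_nonneg_left (hf s') (hK.nonneg s a s')
    _ = (∑ s', K s a s') * M := by rw [Finset.sum_mul]
    _ ≤ 1 * M := mul_le_mul_of_nonneg_right (hK.sum_le_one s a) hM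
    _ = M := one_mul M

theorem IsSubKernel.sum_mul_nonneg (hK : IsSubKernel K) {f : S → ℝ}
    (hf : ∀ s, 0 ≤ f s) (s : S) (a : A) : 0 ≤ ∑ s', K s a s' * f s' :=
  Finset.sum_nonneg fun s' _ => mul_nonneg (hK.nonneg s a s') (hf s')

/-- Comparison principle: a function which at every state is dominated by its own discounted
expectation under some action is nonpositive. -/
theorem IsSubKernel.nonpos_of_le (hK : IsSubKernel K) (hγ0 : 0 ≤ γ) (hγ1 : γ < 1) {f : S → ℝ}
    (h : ∀ s, ∃ a, f s ≤ γ * ∑ s', K s a s' * f s') (s : S) : f s ≤ 0 := by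
  have : Nonempty S := ⟨s⟩
  obtain ⟨m, hm⟩ := Finite.exists_max f
  by_contra! hs
  have hpos : 0 < f m := hs.trans_le (hm s)
  obtain ⟨a, ha⟩ := h m
  have h1 := mul_le_mul_of_nonneg_left (hK.sum_mul_le hpos.le hm m a) hγ0
  nlinarith

theorem IsSubKernel.nonpos_of_le_avg (hK : IsSubKernel K) (hγ0 : 0 ≤ γ) (hγ1 : γ < 1)
    (hπ : IsPolicy π) {f : S → ℝ}
    (h : ∀ s, f s ≤ ∑ a, π s a * (γ * ∑ s', K s a s' * f s')) (s : S) : f s ≤ 0 :=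
  hK.nonpos_of_le hγ0 hγ1 (fun s => exists_le_of_le_sum_mul (hπ s) (h s)) s

theorem abs_expectedReward_le (hK : IsSubKernel K) (hπ : IsPolicy π) {l : S → A → ℝ} {M : ℝ}
    (hl : ∀ s a, |l s a| ≤ M) (t : ℕ) (s : S) : |expectedReward K π l t s| ≤ M := by
  have hM : 0 ≤ M := by
    obtain ⟨a, -⟩ := exists_le_of_le_sum_mul (hπ s) (f := fun _ => 0) (x := 0) (by simp)
    exact (abs_nonneg _).trans (hl s a)
  induction t generalizing s with
  | zero =>
    rw [abs_le, expectedReward]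
    exact ⟨le_sum_mul_of_le (hπ s) fun a => (abs_le.1 (hl s a)).1,
      sum_mul_le_of_le (hπ s) fun a => (abs_le.1 (hl s a)).2⟩
  | succ t ih =>
    rw [abs_le, expectedReward]
    refine ⟨le_sum_mul_of_le (hπ s) fun a => ?_, sum_mul_le_of_le (hπ s) fun a => ?_⟩
    · have := hK.sum_mul_le hM (f := fun s' => -expectedReward K π l t s')
        (fun s' => by linarith [(abs_le.1 (ih s')).1]) s a
      simp only [mul_neg, Finset.sum_neg_distrib] at this
      linarith
    · exact hK.sum_mul_le hM (fun s' => (abs_le.1 (ih s')).2) s a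

theorem summable_expectedReward (hγ0 : 0 ≤ γ) (hγ1 : γ < 1) (hK : IsSubKernel K)
    (hπ : IsPolicy π) (l : S → A → ℝ) (s : S) :
    Summable fun t : ℕ => γ ^ t * expectedReward K π l t s := by
  have hl : ∀ s a, |l s a| ≤ ∑ s, ∑ a, |l s a| := fun s a =>
    (Finset.single_le_sum (f := fun a => |l s a|) (fun a _ => abs_nonneg (l s a))
      (Finset.mem_univ a)).trans
      (Finset.single_le_sum (f := fun s => ∑ a, |l s a|)
        (fun s _ => Finset.sum_nonneg fun a _ => abs_nonneg (l s a)) (Finset.mem_univ s))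
  refine Summable.of_norm_bounded
    ((summable_geometric_of_lt_one hγ0 hγ1).mul_right (∑ s, ∑ a, |l s a|)) fun t => ?_
  rw [Real.norm_eq_abs, abs_mul, abs_of_nonneg (pow_nonneg hγ0 t)]
  exact mul_le_mul_of_nonneg_left (abs_expectedReward_le hK hπ hl t s) (pow_nonneg hγ0 t)

/-- The Bellman equation of a fixed policy. -/
theorem stateValue_eq (hγ0 : 0 ≤ γ) (hγ1 : γ < 1) (hK : IsSubKernel K) (hπ : IsPolicy π)
    (l : S → A → ℝ) (s : S) :
    stateValue γ K l π s = ∑ a, π s a * qValue γ K l (stateValue γ K l π) s a := by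
  have hsum := summable_expectedReward hγ0 hγ1 hK hπ l
  have hterm : ∀ t, γ ^ (t + 1) * expectedReward K π l (t + 1) s =
      ∑ a, π s a * (γ * ∑ s', K s a s' * (γ ^ t * expectedReward K π l t s')) := by
    intro t
    rw [expectedReward, Finset.mul_sum]
    refine Finset.sum_congr rfl fun a _ => ?_
    rw [Finset.mul_sum, Finset.mul_sum, Finset.mul_sum, Finset.mul_sum]
    exact Finset.sum_congr rfl fun s' _ => by ring
  have hswap : ∑' t, γ ^ (t + 1) * expectedReward K π l (t + 1) s =
      ∑ a, π s a * (γ * ∑ s', K s a s' * stateValue γ K l π s') := by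
    rw [tsum_congr hterm]
    have h1 : ∀ a, HasSum
        (fun t => π s a * (γ * ∑ s', K s a s' * (γ ^ t * expectedReward K π l t s')))
        (π s a * (γ * ∑ s', K s a s' * stateValue γ K l π s')) := fun a =>
      ((hasSum_sum fun s' _ => (hsum s').hasSum.mul_left (K s a s')).mul_left γ).mul_left _
    exact (hasSum_sum fun a _ => h1 a).tsum_eq
  rw [stateValue, (hsum s).tsum_eq_zero_add, hswap]
  simp only [qValue, mul_add, Finset.sum_add_distrib, expectedReward, pow_zero, one_mul]

theorem sum_policy_qValue_sub (l l' : S → A → ℝ) (V W : S → ℝ) (s : S) :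
    ∑ a, π s a * qValue γ K l V s a - ∑ a, π s a * qValue γ K l' W s a =
      ∑ a, π s a * (l s a - l' s a + γ * ∑ s', K s a s' * (V s' - W s')) := by
  rw [← Finset.sum_sub_distrib]
  refine Finset.sum_congr rfl fun a _ => ?_
  simp only [qValue, mul_sub, Finset.sum_sub_distrib]
  ring

theorem stateValue_le_of_super (hγ0 : 0 ≤ γ) (hγ1 : γ < 1) (hK : IsSubKernel K)
    (hπ : IsPolicy π) {l : S → A → ℝ} {W : S → ℝ}
    (hW : ∀ s, ∑ a, π s a * qValue γ K l W s a ≤ W s) (s : S) : stateValue γ K l π s ≤ W s := by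
  have := hK.nonpos_of_le_avg hγ0 hγ1 hπ (f := fun s => stateValue γ K l π s - W s) (fun s => ?_) s
  · simpa using this
  · have h1 := stateValue_eq hγ0 hγ1 hK hπ l s
    have h2 := sum_policy_qValue_sub (γ := γ) (K := K) (π := π) l l (stateValue γ K l π) W s
    simp only [sub_self, zero_add] at h2
    rw [← h2]
    linarith [hW s]

theorem le_stateValue_of_sub (hγ0 : 0 ≤ γ) (hγ1 : γ < 1) (hK : IsSubKernel K)
    (hπ : IsPolicy π) {l : S → A → ℝ} {W : S → ℝ}
    (hW : ∀ s, W s ≤ ∑ a, π s a * qValue γ K l W s a) (s : S) : W s ≤ stateValue γ K l π s := by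
  have := hK.nonpos_of_le_avg hγ0 hγ1 hπ (f := fun s => W s - stateValue γ K l π s) (fun s => ?_) s
  · simpa using this
  · have h1 := stateValue_eq hγ0 hγ1 hK hπ l s
    have h2 := sum_policy_qValue_sub (γ := γ) (K := K) (π := π) l l W (stateValue γ K l π) s
    simp only [sub_self, zero_add] at h2
    rw [← h2]
    linarith [hW s]

theorem stateValue_eq_of_bellman (hγ0 : 0 ≤ γ) (hγ1 : γ < 1) (hK : IsSubKernel K)
    (hπ : IsPolicy π) {l : S → A → ℝ} {W : S → ℝ}
    (hW : ∀ s, W s = ∑ a, π s a * qValue γ K l W s a) (s : S) : stateValue γ K l π s = W s :=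
  le_antisymm (stateValue_le_of_super hγ0 hγ1 hK hπ (fun s => (hW s).ge) s)
    (le_stateValue_of_sub hγ0 hγ1 hK hπ (fun s => (hW s).le) s)

theorem qValue_mono (hγ0 : 0 ≤ γ) (hK : IsSubKernel K) {l : S → A → ℝ} {V W : S → ℝ}
    (h : ∀ s, V s ≤ W s) (s : S) (a : A) : qValue γ K l V s a ≤ qValue γ K l W s a :=
  add_le_add_right (mul_le_mul_of_nonneg_left
    (Finset.sum_le_sum fun s' _ => mul_le_mul_of_nonneg_left (h s') (hK.nonneg s a s')) hγ0) _

theorem stateValue_nonneg (hγ0 : 0 ≤ γ) (hγ1 : γ < 1) (hK : IsSubKernel K)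
    (hπ : IsPolicy π) {l : S → A → ℝ} (hl : ∀ s a, 0 ≤ l s a) (s : S) :
    0 ≤ stateValue γ K l π s :=
  le_stateValue_of_sub hγ0 hγ1 hK hπ (W := fun _ => 0)
    (fun s => le_sum_mul_of_le (hπ s) fun a => by simpa [qValue] using hl s a) s

/-- A bound `M` on the value that is also allowed to depend on the mass lost at `(s, a)`: rewards
at a stopping pair count once, without the factor `1 / (1 - γ)`. -/
theorem stateValue_le_of_le (hγ0 : 0 ≤ γ) (hγ1 : γ < 1) (hK : IsSubKernel K)
    (hπ : IsPolicy π) {l : S → A → ℝ} {M : ℝ}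
    (hl : ∀ s a, l s a ≤ M * (1 - γ * ∑ s', K s a s')) (s : S) :
    stateValue γ K l π s ≤ M :=
  stateValue_le_of_super hγ0 hγ1 hK hπ (W := fun _ => M)
    (fun s => sum_mul_le_of_le (hπ s) fun a => by
      have := hl s a
      rw [qValue, ← Finset.sum_mul]
      linarith) s

theorem stateValue_le_div (hγ0 : 0 ≤ γ) (hγ1 : γ < 1) (hK : IsSubKernel K)
    (hπ : IsPolicy π) {l : S → A → ℝ} {M : ℝ} (hM : 0 ≤ M)
    (hl : ∀ s a, l s a ≤ M) (s : S) : stateValue γ K l π s ≤ M / (1 - γ) := by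
  refine stateValue_le_of_le hγ0 hγ1 hK hπ (fun s a => (hl s a).trans ?_) s
  have h1 : 0 < 1 - γ := by linarith
  rw [div_mul_eq_mul_div, le_div_iff₀ h1]
  exact mul_le_mul_of_nonneg_left
    (by linarith [mul_le_mul_of_nonneg_left (hK.sum_le_one s a) hγ0]) hM

theorem stateValue_add_smul (hγ0 : 0 ≤ γ) (hγ1 : γ < 1) (hK : IsSubKernel K)
    (hπ : IsPolicy π) (l l' : S → A → ℝ) (x : ℝ) (s : S) :
    stateValue γ K (fun s a => l s a + x * l' s a) π s =
      stateValue γ K l π s + x * stateValue γ K l' π s := by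
  refine stateValue_eq_of_bellman hγ0 hγ1 hK hπ
    (W := fun s => stateValue γ K l π s + x * stateValue γ K l' π s) (fun s => ?_) s
  rw [stateValue_eq hγ0 hγ1 hK hπ l s, stateValue_eq hγ0 hγ1 hK hπ l' s, Finset.mul_sum,
    ← Finset.sum_add_distrib]
  refine Finset.sum_congr rfl fun a _ => ?_
  simp only [qValue, mul_add, Finset.sum_add_distrib, Finset.mul_sum]
  have : ∀ s', γ * (K s a s' * (x * stateValue γ K l' π s')) =
      x * (γ * (K s a s' * stateValue γ K l' π s')) := fun s' => by ring
  simp only [this, ← Finset.mul_sum]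
  ring

theorem stateValue_mono (hγ0 : 0 ≤ γ) (hγ1 : γ < 1) (hK : IsSubKernel K)
    (hπ : IsPolicy π) {l l' : S → A → ℝ} (hl : ∀ s a, l s a ≤ l' s a) (s : S) :
    stateValue γ K l π s ≤ stateValue γ K l' π s := by
  refine stateValue_le_of_super hγ0 hγ1 hK hπ (fun s => ?_) s
  rw [stateValue_eq hγ0 hγ1 hK hπ l' s]
  refine Finset.sum_le_sum fun a _ => mul_le_mul_of_nonneg_left ?_ ((hπ s).1 a)
  simp only [qValue]
  linarith [hl s a]

/-- The value of a linear combination of rewards. -/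
theorem stateValue_lagrangian (hγ0 : 0 ≤ γ) (hγ1 : γ < 1) (hK : IsSubKernel K)
    (hπ : IsPolicy π) {d : ℕ} (l : S → A → ℝ) (c : Fin d → S → A → ℝ) (lam : Fin d → ℝ) (s : S) :
    stateValue γ K (fun s a => l s a + ∑ i, lam i * c i s a) π s =
      stateValue γ K l π s + ∑ i, lam i * stateValue γ K (c i) π s := by
  have key : ∀ I : Finset (Fin d),
      stateValue γ K (fun s a => l s a + ∑ i ∈ I, lam i * c i s a) π s =
      stateValue γ K l π s + ∑ i ∈ I, lam i * stateValue γ K (c i) π s := by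
    classical
    intro I
    induction I using Finset.induction_on with
    | empty => simp
    | insert i I hi ih =>
      rw [Finset.sum_insert hi, add_comm (lam i * _), ← add_assoc, ← ih,
        ← stateValue_add_smul hγ0 hγ1 hK hπ]
      congr 1
      funext s a
      rw [Finset.sum_insert hi]
      ring
  exact key Finset.univ

/-! ### The optimal value function -/

/-- `V` solves the Bellman optimality equation for kernel `K` and reward `R`. -/
def IsOptValue (γ : ℝ) (K : S → A → S → ℝ) (R : S → A → ℝ) (V : S → ℝ) : Prop :=
  ∀ s, (∀ a, qValue γ K R V s a ≤ V s) ∧ ∃ a, qValue γ K R V s a = V s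

/-- Two solutions differ by at most `M` if the rewards differ by at most `M` per unit of lost
(discounted) mass. -/
theorem IsOptValue.sub_le (hγ0 : 0 ≤ γ) (hγ1 : γ < 1) (hK : IsSubKernel K)
    {R R' : S → A → ℝ} {V V' : S → ℝ} (hV : IsOptValue γ K R V) (hV' : IsOptValue γ K R' V')
    {M : ℝ} (h : ∀ s a, R' s a - R s a ≤ M * (1 - γ * ∑ s', K s a s')) (s : S) :
    V' s - V s ≤ M := by
  have := hK.nonpos_of_le hγ0 hγ1 (f := fun s => V' s - V s - M) (fun s => ?_) s
  · linarith
  · obtain ⟨a, ha⟩ := (hV' s).2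
    refine ⟨a, ?_⟩
    have h1 := (hV s).1 a
    simp only [qValue] at ha h1
    simp only [mul_sub, Finset.sum_sub_distrib, ← Finset.sum_mul]
    linarith [h s a]

theorem IsOptValue.unique (hγ0 : 0 ≤ γ) (hγ1 : γ < 1) (hK : IsSubKernel K)
    {R : S → A → ℝ} {V V' : S → ℝ} (hV : IsOptValue γ K R V) (hV' : IsOptValue γ K R V') :
    V = V' := by
  funext s
  have h1 := hV.sub_le hγ0 hγ1 hK hV' (M := 0) (by simp) s
  have h2 := hV'.sub_le hγ0 hγ1 hK hV (M := 0) (by simp) s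
  linarith

/-- Existence, by policy improvement: a deterministic policy of maximal total value solves the
optimality equation. -/
theorem exists_isOptValue_detPolicy [Nonempty A] (hγ0 : 0 ≤ γ) (hγ1 : γ < 1) (hK : IsSubKernel K)
    (R : S → A → ℝ) : ∃ m : S → A, IsOptValue γ K R (stateValue γ K R (detPolicy m)) := by
  classical
  obtain ⟨m, hm⟩ := Finite.exists_max fun m : S → A => ∑ s, stateValue γ K R (detPolicy m) s
  have heq : ∀ (m : S → A) s, stateValue γ K R (detPolicy m) s =
      qValue γ K R (stateValue γ K R (detPolicy m)) s (m s) := fun m s => by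
    conv_lhs => rw [stateValue_eq hγ0 hγ1 hK (isPolicy_detPolicy m) R s, sum_detPolicy_mul]
  refine ⟨m, fun s => ⟨fun a => ?_, m s, (heq m s).symm⟩⟩
  by_contra! hlt
  set V := stateValue γ K R (detPolicy m) with hV
  let m' := Function.update m s a
  have hle : ∀ s', V s' ≤ stateValue γ K R (detPolicy m') s' := by
    refine le_stateValue_of_sub hγ0 hγ1 hK (isPolicy_detPolicy m') fun s' => ?_
    rw [sum_detPolicy_mul]
    by_cases h : s' = s
    · subst h
      simpa [m'] using hlt.le
    · simpa [m', h] using (heq m s').le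
  have hstrict : V s < stateValue γ K R (detPolicy m') s := by
    rw [heq m' s]
    refine hlt.trans_le ?_
    simpa [m'] using qValue_mono (l := R) hγ0 hK hle s a
  have := hm m'
  have h2 := Finset.sum_lt_sum (fun s' (_ : s' ∈ Finset.univ) => hle s')
    ⟨s, Finset.mem_univ s, hstrict⟩
  linarith

/-- The optimal value function: the solution of the Bellman optimality equation. -/
def optValue (γ : ℝ) (K : S → A → S → ℝ) (R : S → A → ℝ) : S → ℝ :=
  Classical.epsilon (IsOptValue γ K R)

theorem isOptValue_optValue [Nonempty A] (hγ0 : 0 ≤ γ) (hγ1 : γ < 1) (hK : IsSubKernel K)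
    (R : S → A → ℝ) : IsOptValue γ K R (optValue γ K R) := by
  obtain ⟨m, hm⟩ := exists_isOptValue_detPolicy hγ0 hγ1 hK R
  exact Classical.epsilon_spec (p := IsOptValue γ K R) ⟨_, hm⟩

theorem IsOptValue.stateValue_le (hγ0 : 0 ≤ γ) (hγ1 : γ < 1) (hK : IsSubKernel K)
    {R : S → A → ℝ} {V : S → ℝ} (hV : IsOptValue γ K R V) (hπ : IsPolicy π) (s : S) :
    stateValue γ K R π s ≤ V s :=
  stateValue_le_of_super hγ0 hγ1 hK hπ (fun s => sum_mul_le_of_le (hπ s) (hV s).1) s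

theorem exists_isOptimalPolicy [Nonempty A] (hγ0 : 0 ≤ γ) (hγ1 : γ < 1) (hK : IsSubKernel K)
    (R : S → A → ℝ) : ∃ π, IsOptimalPolicy γ K R π := by
  obtain ⟨m, hm⟩ := exists_isOptValue_detPolicy hγ0 hγ1 hK R
  exact ⟨_, isPolicy_detPolicy m, fun π' hπ' s => hm.stateValue_le hγ0 hγ1 hK hπ' s⟩

theorem IsOptimalPolicy.stateValue_eq_optValue [Nonempty A] (hγ0 : 0 ≤ γ) (hγ1 : γ < 1)
    (hK : IsSubKernel K) {R : S → A → ℝ} (h : IsOptimalPolicy γ K R π) :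
    stateValue γ K R π = optValue γ K R := by
  obtain ⟨m, hm⟩ := exists_isOptValue_detPolicy hγ0 hγ1 hK R
  have h0 := isOptValue_optValue hγ0 hγ1 hK R
  funext s
  refine le_antisymm (h0.stateValue_le hγ0 hγ1 hK h.1 s) ?_
  rw [h0.unique hγ0 hγ1 hK hm]
  exact h.2 _ (isPolicy_detPolicy m) s

/-- If one action per state is strictly better than all others, the optimal policy is the
deterministic policy playing it. -/
theorem IsOptimalPolicy.eq_detPolicy [Nonempty A] (hγ0 : 0 ≤ γ) (hγ1 : γ < 1)
    (hK : IsSubKernel K) {R : S → A → ℝ} (h : IsOptimalPolicy γ K R π) {m : S → A}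
    (hm : ∀ s a, a ≠ m s → qValue γ K R (optValue γ K R) s a < optValue γ K R s) :
    π = detPolicy m := by
  classical
  have h0 := isOptValue_optValue hγ0 hγ1 hK R
  have hπ := h.1
  have hz : ∀ s a, a ≠ m s → π s a = 0 := by
    intro s a ha
    by_contra hne
    have hpos : 0 < π s a := lt_of_le_of_ne ((hπ s).1 a) (Ne.symm hne)
    have h1 := stateValue_eq hγ0 hγ1 hK hπ R s
    rw [h.stateValue_eq_optValue hγ0 hγ1 hK] at h1
    have h2 : ∑ a, π s a * qValue γ K R (optValue γ K R) s a < ∑ a, π s a * optValue γ K R s :=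
      Finset.sum_lt_sum (fun b _ => mul_le_mul_of_nonneg_left ((h0 s).1 b) ((hπ s).1 b))
        ⟨a, Finset.mem_univ a, mul_lt_mul_of_pos_left (hm s a ha) hpos⟩
    rw [← Finset.sum_mul, (hπ s).2, one_mul] at h2
    linarith
  funext s a
  by_cases ha : a = m s
  · have := (hπ s).2
    rw [Finset.sum_eq_single (m s) (fun b _ hb => hz s b hb) (by simp)] at this
    simp [detPolicy, ha, this]
  · simp [detPolicy, ha, hz s a ha]

end Values

/-! ### Evaluation error of a policy under a perturbed kernel -/

/-- The variance of `f` under the weights `p`. -/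
def weightVar {S : Type*} [Fintype S] (p f : S → ℝ) : ℝ :=
  ∑ s, p s * f s ^ 2 - (∑ s, p s * f s) ^ 2

theorem weightVar_eq_sum_sq_sub {S : Type*} [Fintype S] {p : S → ℝ} (hp : p ∈ stdSimplex ℝ S)
    (f : S → ℝ) (x : ℝ) :
    weightVar p f = ∑ s, p s * (f s - x) ^ 2 - (∑ s, p s * f s - x) ^ 2 := by
  have h : ∀ s, p s * (f s - x) ^ 2 = p s * f s ^ 2 - 2 * x * (p s * f s) + x ^ 2 * p s :=
    fun s => by ring
  simp only [h, Finset.sum_add_distrib, Finset.sum_sub_distrib, ← Finset.mul_sum, hp.2, weightVar]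
  ring

theorem weightVar_le_two_mul_add {S : Type*} [Fintype S] {p : S → ℝ} (hp : p ∈ stdSimplex ℝ S)
    {f g : S → ℝ} {η : ℝ} (h : ∀ s, |f s - g s| ≤ η) :
    weightVar p f ≤ 2 * weightVar p g + 2 * η ^ 2 := by
  set x := ∑ s, p s * g s with hx
  rw [weightVar_eq_sum_sq_sub hp f x, weightVar_eq_sum_sq_sub hp g x, ← hx, sub_self]
  have h1 : ∑ s, p s * (f s - x) ^ 2 ≤ ∑ s, p s * (2 * (g s - x) ^ 2 + 2 * η ^ 2) := by
    refine Finset.sum_le_sum fun s _ => mul_le_mul_of_nonneg_left ?_ (hp.1 s)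
    have h2 : (f s - g s) ^ 2 ≤ η ^ 2 := sq_le_sq' (abs_le.1 (h s)).1 (abs_le.1 (h s)).2
    nlinarith [sq_nonneg ((f s - g s) - (g s - x))]
  have h3 : ∑ s, p s * (2 * (g s - x) ^ 2 + 2 * η ^ 2) =
      2 * ∑ s, p s * (g s - x) ^ 2 + 2 * η ^ 2 := by
    simp only [mul_add, Finset.sum_add_distrib, ← Finset.sum_mul, hp.2, Finset.mul_sum]
    congr 1
    · exact Finset.sum_congr rfl fun s _ => by ring
    · ring
  nlinarith [sq_nonneg (∑ s, p s * f s - x)]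

theorem sq_sum_mul_le {A : Type*} [Fintype A] {p : A → ℝ} (hp : p ∈ stdSimplex ℝ A) (f : A → ℝ) :
    (∑ a, p a * f a) ^ 2 ≤ ∑ a, p a * f a ^ 2 := by
  have h := weightVar_eq_sum_sq_sub hp f (∑ a, p a * f a)
  rw [sub_self] at h
  have : 0 ≤ ∑ a, p a * (f a - ∑ a, p a * f a) ^ 2 :=
    Finset.sum_nonneg fun a _ => mul_nonneg (hp.1 a) (sq_nonneg _)
  unfold weightVar at h
  linarith

section EvaluationError

variable {S A : Type*} [Fintype S] [Fintype A] {γ : ℝ} {P P' : S → A → S → ℝ} {π : S → A → ℝ}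

/-- Total-variance bound. The value `V` of `π` under `P'` accumulates, along the chain with the
other kernel `P`, discounted one-step variances of order `(1 - γ)⁻²` only, up to the accumulated
one-step error `H` of using `P` for `P'`. The reason is that `V` solves under `P` the Bellman
equation with reward off by the one-step error, so that
`F = 2 / (1 - γ) * (1 / (1 - γ) + H) - V ^ 2` is a supersolution. -/
theorem stateValue_weightVar_le (hγ0 : 0 ≤ γ) (hγ1 : γ < 1) (hP : ∀ s a, P s a ∈ stdSimplex ℝ S)
    (hP' : ∀ s a, P' s a ∈ stdSimplex ℝ S) (hπ : IsPolicy π) {l : S → A → ℝ}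
    (hl : ∀ s a, l s a ∈ Set.Icc (0 : ℝ) 1) {V : S → ℝ} (hV : V = stateValue γ P' l π)
    {e : S → A → ℝ}
    (he : ∀ s a, e s a = γ * |∑ s', P' s a s' * V s' - ∑ s', P s a s' * V s'|) (s : S) :
    stateValue γ P (fun s a => γ * weightVar (P s a) V) π s ≤
      2 / (1 - γ) * (1 / (1 - γ) + stateValue γ P e π s) - V s ^ 2 := by
  have hK := isSubKernel_of_mem_stdSimplex hP
  have hK' := isSubKernel_of_mem_stdSimplex hP'
  have h1γ : 0 < 1 - γ := by linarith
  set H := stateValue γ P e π with hH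
  have hV0 : ∀ s, 0 ≤ V s := fun s =>
    hV ▸ stateValue_nonneg hγ0 hγ1 hK' hπ (fun s a => (hl s a).1) s
  have hV1 : ∀ s, V s ≤ 1 / (1 - γ) := fun s =>
    hV ▸ stateValue_le_div hγ0 hγ1 hK' hπ zero_le_one (fun s a => (hl s a).2) s
  refine stateValue_le_of_super hγ0 hγ1 hK hπ
    (W := fun s => 2 / (1 - γ) * (1 / (1 - γ) + H s) - V s ^ 2) (fun s => ?_) s
  have hVs : V s = ∑ a, π s a * qValue γ P' l V s a := by
    rw [hV]; exact stateValue_eq hγ0 hγ1 hK' hπ l s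
  have hHs : H s = ∑ a, π s a * qValue γ P e H s a := stateValue_eq hγ0 hγ1 hK hπ e s
  have hpt : ∀ a, qValue γ P (fun s a => γ * weightVar (P s a) V)
      (fun s => 2 / (1 - γ) * (1 / (1 - γ) + H s) - V s ^ 2) s a ≤
      2 / (1 - γ) * (1 / (1 - γ) + qValue γ P e H s a) - qValue γ P' l V s a ^ 2 := by
    intro a
    have hsum : ∑ s', P s a s' * (2 / (1 - γ) * (1 / (1 - γ) + H s') - V s' ^ 2) =
        2 / (1 - γ) * (1 / (1 - γ) + ∑ s', P s a s' * H s') - ∑ s', P s a s' * V s' ^ 2 := by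
      simp only [mul_sub, mul_add, Finset.sum_sub_distrib, Finset.sum_add_distrib,
        ← Finset.sum_mul, (hP s a).2, one_mul, Finset.mul_sum]
      congr 2
      exact Finset.sum_congr rfl fun s' _ => by ring
    set x := qValue γ P' l V s a with hx
    set y := ∑ s', P s a s' * V s' with hy
    set z := ∑ s', P' s a s' * V s' with hz
    have hxe : x = l s a + γ * z := rfl
    have hz0 : 0 ≤ z := hK'.sum_mul_nonneg hV0 s a
    have hz1 : z ≤ 1 / (1 - γ) := hK'.sum_mul_le (by positivity) hV1 s a
    have hx0 : 0 ≤ x := by rw [hxe]; have := (hl s a).1; positivity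
    have hx1 : x ≤ 1 / (1 - γ) := by
      have h2 : 1 / (1 - γ) = 1 + γ * (1 / (1 - γ)) := by field_simp; ring
      rw [hxe, h2]
      exact add_le_add (hl s a).2 (mul_le_mul_of_nonneg_left hz1 hγ0)
    have he0 : 0 ≤ e s a := by rw [he]; positivity
    have hδ : γ * (z - y) ≤ e s a := by
      rw [he]; exact mul_le_mul_of_nonneg_left (le_abs_self _) hγ0
    have hsq : x ^ 2 - γ * y ^ 2 ≤ 2 / (1 - γ) * (1 + e s a) := by
      have h1 : (γ * y) ^ 2 ≤ γ * y ^ 2 := by nlinarith [mul_nonneg hγ0 (sq_nonneg y)]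
      have h2 : x ^ 2 - (γ * y) ^ 2 ≤ 2 * x * (x - γ * y) := by nlinarith [sq_nonneg (x - γ * y)]
      have h3 : x - γ * y ≤ 1 + e s a := by
        have := (hl s a).2
        rw [hxe]; linarith
      have h4 : 2 * x * (x - γ * y) ≤ 2 * x * (1 + e s a) :=
        mul_le_mul_of_nonneg_left h3 (by positivity)
      have h5 : 2 * x * (1 + e s a) ≤ 2 * (1 / (1 - γ)) * (1 + e s a) := by gcongr
      calc x ^ 2 - γ * y ^ 2 ≤ 2 * (1 / (1 - γ)) * (1 + e s a) := by linarith
        _ = 2 / (1 - γ) * (1 + e s a) := by ring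
    have hgeom : 2 / (1 - γ) * (1 / (1 - γ)) - γ * (2 / (1 - γ) * (1 / (1 - γ))) =
        2 / (1 - γ) := by field_simp
    simp only [qValue] at hsum ⊢
    rw [hsum, weightVar]
    linarith
  have hJ := sq_sum_mul_le (hπ s) fun a => qValue γ P' l V s a
  calc _ ≤ ∑ a, π s a * (2 / (1 - γ) * (1 / (1 - γ) + qValue γ P e H s a) -
          qValue γ P' l V s a ^ 2) :=
        Finset.sum_le_sum fun a _ => mul_le_mul_of_nonneg_left (hpt a) ((hπ s).1 a)
    _ = 2 / (1 - γ) * (1 / (1 - γ) + H s) - ∑ a, π s a * qValue γ P' l V s a ^ 2 := by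
        rw [hHs]
        simp only [mul_sub, mul_add, Finset.sum_sub_distrib, Finset.sum_add_distrib,
          ← Finset.sum_mul, (hπ s).2, one_mul, Finset.mul_sum]
        congr 2
        exact Finset.sum_congr rfl fun s' _ => by ring
    _ ≤ _ := by rw [hVs]; linarith

/-- If the one-step error of `V`, the value of `π` under `P'`, is at most a multiple of its variance
plus a small constant, then `V` is within `ε / 8` of the value under `P`. The multiple may be as
large as `(1 - γ) ^ 2 * ε`, because variances accumulate only to order `(1 - γ)⁻²`. The accumulated
error occurs on both sides of the estimate and is absorbed by the left one, which is why the whole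
range `ε ≤ 1 / (1 - γ)` is covered. -/
theorem abs_stateValue_sub_le (hγ0 : 0 ≤ γ) (hγ1 : γ < 1) (hP : ∀ s a, P s a ∈ stdSimplex ℝ S)
    (hP' : ∀ s a, P' s a ∈ stdSimplex ℝ S) (hπ : IsPolicy π) {l : S → A → ℝ}
    (hl : ∀ s a, l s a ∈ Set.Icc (0 : ℝ) 1) {ε : ℝ} (hε0 : 0 < ε) (hε1 : ε ≤ 1 / (1 - γ))
    (h : ∀ s a, |∑ s', P' s a s' * stateValue γ P' l π s' -
        ∑ s', P s a s' * stateValue γ P' l π s'| ≤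
      (1 - γ) ^ 2 * ε / 64 * weightVar (P s a) (stateValue γ P' l π) + ε * (1 - γ) / 32) (s : S) :
    |stateValue γ P' l π s - stateValue γ P l π s| ≤ ε / 8 := by
  have hK := isSubKernel_of_mem_stdSimplex hP
  have hK' := isSubKernel_of_mem_stdSimplex hP'
  have h1γ : 0 < 1 - γ := by linarith
  set V := stateValue γ P' l π with hV
  set e : S → A → ℝ := fun s a => γ * |∑ s', P' s a s' * V s' - ∑ s', P s a s' * V s'| with he
  set H := stateValue γ P e π with hH
  have hVs : ∀ s, V s = ∑ a, π s a * qValue γ P' l V s a := stateValue_eq hγ0 hγ1 hK' hπ l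
  have hup : V s ≤ stateValue γ P l π s + 1 * H s := by
    rw [hH, ← stateValue_add_smul hγ0 hγ1 hK hπ]
    refine le_stateValue_of_sub hγ0 hγ1 hK hπ (fun s => ?_) s
    rw [hVs s]
    refine Finset.sum_le_sum fun a _ => mul_le_mul_of_nonneg_left ?_ ((hπ s).1 a)
    have := mul_le_mul_of_nonneg_left
      (le_abs_self (∑ s', P' s a s' * V s' - ∑ s', P s a s' * V s')) hγ0
    simp only [qValue, he]
    linarith
  have hlo : stateValue γ P l π s + (-1) * H s ≤ V s := by
    rw [hH, ← stateValue_add_smul hγ0 hγ1 hK hπ]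
    refine stateValue_le_of_super hγ0 hγ1 hK hπ (fun s => ?_) s
    rw [hVs s]
    refine Finset.sum_le_sum fun a _ => mul_le_mul_of_nonneg_left ?_ ((hπ s).1 a)
    have := mul_le_mul_of_nonneg_left
      (neg_abs_le (∑ s', P' s a s' * V s' - ∑ s', P s a s' * V s')) hγ0
    simp only [qValue, he]
    linarith
  have : Nonempty S := ⟨s⟩
  obtain ⟨s₀, hs₀⟩ := Finite.exists_max H
  have hmain : H s₀ ≤ ε / (32 * (1 - γ)) * (1 - γ) +
      (1 - γ) ^ 2 * ε / 64 * (2 / (1 - γ) * (1 / (1 - γ) + H s₀)) := by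
    have h1 : H s₀ ≤ stateValue γ P
        (fun s a => ε * (1 - γ) / 32 + (1 - γ) ^ 2 * ε / 64 * (γ * weightVar (P s a) V)) π s₀ := by
      refine stateValue_mono hγ0 hγ1 hK hπ (fun s a => ?_) s₀
      have h2 := mul_le_mul_of_nonneg_left (h s a) hγ0
      have h3 : γ * (ε * (1 - γ) / 32) ≤ ε * (1 - γ) / 32 :=
        mul_le_of_le_one_left (by positivity) hγ1.le
      simp only [he]
      linarith
    rw [stateValue_add_smul hγ0 hγ1 hK hπ] at h1
    have h2 := stateValue_weightVar_le hγ0 hγ1 hP hP' hπ hl hV (e := e) (fun _ _ => rfl) s₀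
    have h3 : stateValue γ P (fun _ _ => ε * (1 - γ) / 32) π s₀ ≤ ε * (1 - γ) / 32 / (1 - γ) :=
      stateValue_le_div hγ0 hγ1 hK hπ (by positivity) (fun _ _ => le_rfl) s₀
    have h4 : stateValue γ P (fun s a => γ * weightVar (P s a) V) π s₀ ≤
        2 / (1 - γ) * (1 / (1 - γ) + H s₀) := h2.trans (by linarith [sq_nonneg (V s₀)])
    have h5 := mul_le_mul_of_nonneg_left h4 (show 0 ≤ (1 - γ) ^ 2 * ε / 64 by positivity)
    have h6 : ε * (1 - γ) / 32 / (1 - γ) = ε / (32 * (1 - γ)) * (1 - γ) := by field_simp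
    linarith
  have hH0 : 0 ≤ H s₀ := stateValue_nonneg hγ0 hγ1 hK hπ (fun s a => by positivity) s₀
  have hbound : H s₀ ≤ ε / 8 := by
    have h1 : (1 - γ) ^ 2 * ε / 64 * (2 / (1 - γ) * (1 / (1 - γ) + H s₀)) =
        ε / 32 + ε * (1 - γ) / 32 * H s₀ := by field_simp; ring
    have h2 : ε / (32 * (1 - γ)) * (1 - γ) = ε / 32 := by field_simp
    have h3 : ε * (1 - γ) ≤ 1 := by rwa [le_div_iff₀ h1γ] at hε1
    rw [h1, h2] at hmain
    nlinarith
  have := hs₀ s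
  rw [abs_le]
  constructor <;> linarith

end EvaluationError

/-! ### Stopping at one state-action pair -/

section Stopping

variable {S A : Type*} [Fintype S] [Fintype A] {γ : ℝ} {K : S → A → S → ℝ} {π : S → A → ℝ}

/-- The kernel `K` stopped as soon as `a₀` is played in `s₀`. It does not depend on the row of `K`
at `(s₀, a₀)`. -/
def stopAt {S A : Type*} (K : S → A → S → ℝ) (s₀ : S) (a₀ : A) (s : S) (a : A) (s' : S) : ℝ :=
  open Classical in if s = s₀ ∧ a = a₀ then 0 else K s a s'

/-- The reward `R` with its entry at `(s₀, a₀)` replaced by `q`. -/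
def setReward {S A : Type*} (R : S → A → ℝ) (s₀ : S) (a₀ : A) (q : ℝ) (s : S) (a : A) : ℝ :=
  open Classical in if s = s₀ ∧ a = a₀ then q else R s a

/-- The value of `π` for the reward `l` when playing `a₀` in `s₀` ends the process with a final
reward `q`. -/
def stopValue (γ : ℝ) (K : S → A → S → ℝ) (l : S → A → ℝ) (π : S → A → ℝ) (s₀ : S) (a₀ : A)
    (q : ℝ) : S → ℝ :=
  stateValue γ (stopAt K s₀ a₀) (setReward l s₀ a₀ q) π

/-- A policy choice that attains the Bellman maximum; it is a function of the set of maximizing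
pairs alone. -/
def greedy (γ : ℝ) [Nonempty A] (K : S → A → S → ℝ) (R : S → A → ℝ) (s : S) : A :=
  Classical.epsilon fun a => qValue γ K R (optValue γ K R) s a = optValue γ K R s

theorem IsSubKernel.stopAt (hK : IsSubKernel K) (s₀ : S) (a₀ : A) :
    IsSubKernel (stopAt K s₀ a₀) := by
  refine ⟨fun s a s' => ?_, fun s a => ?_⟩
  · by_cases h : s = s₀ ∧ a = a₀ <;> simp [_root_.stopAt, h, hK.nonneg]
  · by_cases h : s = s₀ ∧ a = a₀ <;> simp [_root_.stopAt, h, hK.sum_le_one]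

/-- Stopping at `(s₀, a₀)` with its own action value as final reward changes no action value. -/
theorem qValue_stopAt (R : S → A → ℝ) (V : S → ℝ) (s₀ : S) (a₀ : A) (s : S) (a : A) :
    qValue γ (stopAt K s₀ a₀) (setReward R s₀ a₀ (qValue γ K R V s₀ a₀)) V s a =
      qValue γ K R V s a := by
  by_cases h : s = s₀ ∧ a = a₀
  · obtain ⟨rfl, rfl⟩ := h
    simp [qValue, stopAt, setReward]
  · simp [qValue, stopAt, setReward, h]

theorem setReward_sub_le (hγ0 : 0 ≤ γ) (hγ1 : γ < 1) (hK : IsSubKernel K) (R : S → A → ℝ)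
    (s₀ : S) (a₀ : A) {q q' η : ℝ} (h : q' - q ≤ η) (hη : 0 ≤ η) (s : S) (a : A) :
    setReward R s₀ a₀ q' s a - setReward R s₀ a₀ q s a ≤
      η * (1 - γ * ∑ s', stopAt K s₀ a₀ s a s') := by
  by_cases hs : s = s₀ ∧ a = a₀
  · simpa [setReward, stopAt, hs] using h
  · simp only [setReward, hs, if_false, sub_self]
    refine mul_nonneg hη ?_
    nlinarith [(hK.stopAt s₀ a₀).sum_le_one s a]

theorem abs_stopValue_sub_le (hγ0 : 0 ≤ γ) (hγ1 : γ < 1) (hK : IsSubKernel K)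
    (hπ : IsPolicy π) (l : S → A → ℝ) (s₀ : S) (a₀ : A) {q η : ℝ}
    (h : |q - qValue γ K l (stateValue γ K l π) s₀ a₀| ≤ η) (s : S) :
    |stopValue γ K l π s₀ a₀ q s - stateValue γ K l π s| ≤ η := by
  set q' := qValue γ K l (stateValue γ K l π) s₀ a₀
  have hη : 0 ≤ η := (abs_nonneg _).trans h
  have hK' := hK.stopAt s₀ a₀
  have heq : ∀ s, stateValue γ (stopAt K s₀ a₀) (setReward l s₀ a₀ q') π s =
      stateValue γ K l π s := fun s => by
    refine stateValue_eq_of_bellman hγ0 hγ1 hK' hπ (fun s => ?_) s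
    simp only [q', qValue_stopAt]
    exact stateValue_eq hγ0 hγ1 hK hπ l s
  have hlin : ∀ x y, stateValue γ (stopAt K s₀ a₀) (setReward l s₀ a₀ x) π s -
      stateValue γ (stopAt K s₀ a₀) (setReward l s₀ a₀ y) π s =
      stateValue γ (stopAt K s₀ a₀)
        (fun s a => setReward l s₀ a₀ x s a + (-1) * setReward l s₀ a₀ y s a) π s := fun x y => by
    rw [stateValue_add_smul hγ0 hγ1 hK' hπ]
    ring
  have hle : ∀ x y, x - y ≤ η → stateValue γ (stopAt K s₀ a₀) (setReward l s₀ a₀ x) π s -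
      stateValue γ (stopAt K s₀ a₀) (setReward l s₀ a₀ y) π s ≤ η := fun x y hxy => by
    rw [hlin]
    refine stateValue_le_of_le hγ0 hγ1 hK' hπ (fun s a => ?_) s
    have := setReward_sub_le hγ0 hγ1 hK l s₀ a₀ hxy hη s a
    linarith
  rw [← heq, stopValue, abs_le]
  obtain ⟨h1, h2⟩ := abs_le.1 h
  have h3 := hle q q' h2
  have h4 := hle q' q (by linarith)
  constructor <;> linarith

theorem stopValue_mem_Icc (hγ0 : 0 ≤ γ) (hγ1 : γ < 1) (hK : IsSubKernel K)
    (hπ : IsPolicy π) {l : S → A → ℝ} (hl : ∀ s a, l s a ∈ Set.Icc (0 : ℝ) 1) (s₀ : S) (a₀ : A)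
    {q : ℝ} (hq0 : 0 ≤ q) (hq1 : q ≤ 1 / (1 - γ)) (s : S) :
    stopValue γ K l π s₀ a₀ q s ∈ Set.Icc 0 (1 / (1 - γ)) := by
  have hK' := hK.stopAt s₀ a₀
  have h1γ : 0 < 1 - γ := by linarith
  refine ⟨stateValue_nonneg hγ0 hγ1 hK' hπ (fun s a => ?_) s,
    stateValue_le_of_le hγ0 hγ1 hK' hπ (fun s a => ?_) s⟩
  · by_cases hs : s = s₀ ∧ a = a₀
    · simpa [setReward, hs] using hq0
    · simpa [setReward, hs] using (hl s a).1
  · by_cases hs : s = s₀ ∧ a = a₀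
    · simpa [setReward, stopAt, hs] using hq1
    · have h1 : setReward l s₀ a₀ q s a ≤ 1 := by simpa [setReward, hs] using (hl s a).2
      rw [one_div, inv_mul_eq_div, le_div_iff₀ h1γ]
      nlinarith [hK'.sum_le_one s a, mul_le_mul_of_nonneg_left (hK'.sum_le_one s a) hγ0]

/-- In every state one action beats all others by at least `ι`. -/
def HasGap (γ : ℝ) (K : S → A → S → ℝ) (R : S → A → ℝ) (ι : ℝ) : Prop :=
  ∀ s, ∃ a, ∀ a' ≠ a, qValue γ K R (optValue γ K R) s a' + ι ≤ optValue γ K R s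

/-- Under a gap `ι` the optimal policy is recovered from the stopped process, as soon as the final
reward is within `ι / 2` of the optimal action value at the stopping pair. -/
theorem IsOptimalPolicy.eq_greedy_stopAt [Nonempty A] (hγ0 : 0 ≤ γ) (hγ1 : γ < 1)
    (hK : IsSubKernel K) {R : S → A → ℝ} (h : IsOptimalPolicy γ K R π) {ι : ℝ} (hι : 0 < ι)
    (hgap : HasGap γ K R ι) (s₀ : S) (a₀ : A) {q : ℝ}
    (hq : |q - qValue γ K R (optValue γ K R) s₀ a₀| < ι / 2) :
    π = detPolicy (greedy γ (stopAt K s₀ a₀) (setReward R s₀ a₀ q)) := by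
  have hK' := hK.stopAt s₀ a₀
  set V := optValue γ K R with hV
  set q' := qValue γ K R V s₀ a₀ with hq'
  set W := optValue γ (stopAt K s₀ a₀) (setReward R s₀ a₀ q) with hW
  have hV0 : IsOptValue γ K R V := isOptValue_optValue hγ0 hγ1 hK R
  have hV1 : IsOptValue γ (stopAt K s₀ a₀) (setReward R s₀ a₀ q') V := by
    intro s
    simp only [hq', qValue_stopAt]
    exact hV0 s
  have hW1 : IsOptValue γ (stopAt K s₀ a₀) (setReward R s₀ a₀ q) W :=
    isOptValue_optValue hγ0 hγ1 hK' _
  set η := |q - q'| with hη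
  have hη0 : 0 ≤ η := abs_nonneg _
  have h1 : ∀ s, W s - V s ≤ η := hV1.sub_le hγ0 hγ1 hK' hW1
    (setReward_sub_le hγ0 hγ1 hK R s₀ a₀ (le_abs_self _) hη0)
  have h2 : ∀ s, V s - W s ≤ η := hW1.sub_le hγ0 hγ1 hK' hV1
    (setReward_sub_le hγ0 hγ1 hK R s₀ a₀ (by rw [hη, abs_sub_comm]; exact le_abs_self _) hη0)
  have hQ : ∀ s a, qValue γ (stopAt K s₀ a₀) (setReward R s₀ a₀ q) W s a ≤
      qValue γ K R V s a + η := by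
    intro s a
    rw [← qValue_stopAt R V s₀ a₀ s a]
    have h3 := setReward_sub_le (q := q') (q' := q) hγ0 hγ1 hK R s₀ a₀ (le_abs_self _) hη0 s a
    have h4 : ∑ s', stopAt K s₀ a₀ s a s' * W s' ≤
        ∑ s', stopAt K s₀ a₀ s a s' * V s' + (∑ s', stopAt K s₀ a₀ s a s') * η := by
      rw [Finset.sum_mul, ← Finset.sum_add_distrib]
      refine Finset.sum_le_sum fun s' _ => ?_
      rw [← mul_add]
      exact mul_le_mul_of_nonneg_left (by linarith [h1 s']) (hK'.nonneg s a s')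
    have h5 := mul_le_mul_of_nonneg_left h4 hγ0
    simp only [qValue] at hq' ⊢
    rw [← hq']
    linarith
  choose m hm using hgap
  have hgreedy : greedy γ (stopAt K s₀ a₀) (setReward R s₀ a₀ q) = m := by
    funext s
    by_contra hne
    have h3 : qValue γ (stopAt K s₀ a₀) (setReward R s₀ a₀ q) W s
        (greedy γ (stopAt K s₀ a₀) (setReward R s₀ a₀ q) s) = W s :=
      Classical.epsilon_spec (p := fun a =>
        qValue γ (stopAt K s₀ a₀) (setReward R s₀ a₀ q) W s a = W s) (hW1 s).2
    have h4 := hm s _ hne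
    have h5 := hQ s (greedy γ (stopAt K s₀ a₀) (setReward R s₀ a₀ q) s)
    have h6 := h2 s
    linarith
  rw [hgreedy]
  refine h.eq_detPolicy hγ0 hγ1 hK fun s a ha => ?_
  have := hm s a ha
  linarith

theorem exists_nat_mul_near {x M h : ℝ} (h0 : 0 < h) (hx : 0 ≤ x) (hxM : x ≤ M) :
    ∃ k ∈ Finset.range (⌊M / h⌋₊ + 1), |(k : ℝ) * h - x| < h := by
  refine ⟨⌊x / h⌋₊, ?_, ?_⟩
  · rw [Finset.mem_range, Nat.lt_succ_iff]
    exact Nat.floor_le_floor (by gcongr)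
  · have h1 := Nat.floor_le (div_nonneg hx h0.le)
    have h2 := Nat.lt_floor_add_one (x / h)
    rw [le_div_iff₀ h0] at h1
    rw [div_lt_iff₀ h0] at h2
    rw [abs_lt]
    constructor <;> linarith

/-- The linearized Bernstein inequality for the estimate `p'` of `p` and the function `f`. -/
def Concentrated (θ β : ℝ) (p' p f : S → ℝ) : Prop :=
  |∑ s, p' s * f s - ∑ s, p s * f s| ≤ θ * weightVar p f + β

/-- The condition on the estimated row at `(s₀, a₀)` under which a policy is evaluated correctly:
concentration for the stopped values, with final rewards in a net of `[0, 1 / (1 - γ)]`. Both the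
stopped values and the net are independent of that row. -/
def RowConcentrated (γ ε : ℝ) (P P' : S → A → S → ℝ) (l π : S → A → ℝ) (s₀ : S) (a₀ : A) : Prop :=
  ∀ k ∈ Finset.range (⌊1 / (1 - γ) / (ε * (1 - γ) / 256)⌋₊ + 1),
    Concentrated ((1 - γ) ^ 2 * ε / 128) (ε * (1 - γ) / 64) (P' s₀ a₀) (P s₀ a₀)
      (stopValue γ P' l π s₀ a₀ (k * (ε * (1 - γ) / 256)))

/-- The constants of `RowConcentrated` leave room for the discretization of the final rewards: passing
from the stopped value to the value of the policy at most doubles the variance, and costs a few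
multiples of the mesh `ε * (1 - γ) / 256`. -/
theorem abs_stateValue_sub_le_of_rowConcentrated {P P' : S → A → S → ℝ} (hγ0 : 0 ≤ γ)
    (hγ1 : γ < 1) (hP : ∀ s a, P s a ∈ stdSimplex ℝ S) (hP' : ∀ s a, P' s a ∈ stdSimplex ℝ S)
    (hπ : IsPolicy π) {l : S → A → ℝ} (hl : ∀ s a, l s a ∈ Set.Icc (0 : ℝ) 1) {ε : ℝ}
    (hε0 : 0 < ε) (hε1 : ε ≤ 1 / (1 - γ))
    (h : ∀ s₀ a₀, RowConcentrated γ ε P P' l π s₀ a₀) (s : S) :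
    |stateValue γ P' l π s - stateValue γ P l π s| ≤ ε / 8 := by
  have hK' := isSubKernel_of_mem_stdSimplex hP'
  have h1γ : 0 < 1 - γ := by linarith
  refine abs_stateValue_sub_le hγ0 hγ1 hP hP' hπ hl hε0 hε1 (fun s₀ a₀ => ?_) s
  set V := stateValue γ P' l π with hV
  set η := ε * (1 - γ) / 256 with hη
  have hη0 : 0 < η := by positivity
  have hV0 : ∀ s, 0 ≤ V s := stateValue_nonneg hγ0 hγ1 hK' hπ (fun s a => (hl s a).1)
  have hV1 : ∀ s, V s ≤ 1 / (1 - γ) :=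
    stateValue_le_div hγ0 hγ1 hK' hπ zero_le_one (fun s a => (hl s a).2)
  have hq0 : 0 ≤ qValue γ P' l V s₀ a₀ :=
    add_nonneg (hl s₀ a₀).1 (mul_nonneg hγ0 (hK'.sum_mul_nonneg hV0 s₀ a₀))
  have hq1 : qValue γ P' l V s₀ a₀ ≤ 1 / (1 - γ) := by
    have h2 : 1 / (1 - γ) = 1 + γ * (1 / (1 - γ)) := by field_simp; ring
    rw [h2]
    exact add_le_add (hl s₀ a₀).2
      (mul_le_mul_of_nonneg_left (hK'.sum_mul_le (by positivity) hV1 s₀ a₀) hγ0)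
  obtain ⟨k, hk, hkq⟩ := exists_nat_mul_near hη0 hq0 hq1
  have hc := h s₀ a₀ k hk
  set W := stopValue γ P' l π s₀ a₀ (k * η) with hW
  have hWV : ∀ s, |W s - V s| ≤ η := abs_stopValue_sub_le hγ0 hγ1 hK' hπ l s₀ a₀ hkq.le
  have hvar := weightVar_le_two_mul_add (hP s₀ a₀) hWV
  have hrow : ∀ p : S → ℝ, p ∈ stdSimplex ℝ S →
      |∑ s, p s * V s - ∑ s, p s * W s| ≤ η := by
    intro p hp
    rw [← Finset.sum_sub_distrib, abs_le]
    simp only [← mul_sub]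
    exact ⟨le_sum_mul_of_le hp fun s => by linarith [(abs_le.1 (hWV s)).2],
      sum_mul_le_of_le hp fun s => by linarith [(abs_le.1 (hWV s)).1]⟩
  have h1 := hrow _ (hP s₀ a₀)
  have h2 := hrow _ (hP' s₀ a₀)
  have hθ : (0 : ℝ) ≤ (1 - γ) ^ 2 * ε / 128 := by positivity
  have h3 := mul_le_mul_of_nonneg_left hvar hθ
  have hε2 : ε * (1 - γ) ≤ 1 := by rwa [le_div_iff₀ h1γ] at hε1
  have h4 : (1 - γ) ^ 2 * ε / 128 * (2 * η ^ 2) ≤ η := by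
    have h5 : (1 - γ) * (ε * (1 - γ)) ≤ 1 * 1 :=
      mul_le_mul (by linarith) hε2 (by positivity) zero_le_one
    have h6 : η ≤ 1 := by rw [hη]; linarith
    nlinarith [mul_nonneg hη0.le hη0.le]
  simp only [Concentrated] at hc
  have h7 : |∑ s', P' s₀ a₀ s' * V s' - ∑ s', P s₀ a₀ s' * V s'| ≤
      |∑ s', P' s₀ a₀ s' * W s' - ∑ s', P s₀ a₀ s' * W s'| + 2 * η := by
    rw [abs_le] at h1 h2 ⊢
    obtain ⟨h8, h9⟩ := abs_le.1 (le_refl |∑ s', P' s₀ a₀ s' * W s' - ∑ s', P s₀ a₀ s' * W s'|)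
    constructor <;> linarith
  linarith

/-- Under a gap, the optimal policy is among the greedy policies of the stopped process with final
reward in a net of `[0, M / (1 - γ)]`. -/
theorem IsOptimalPolicy.exists_eq_greedy [Nonempty A] (hγ0 : 0 ≤ γ) (hγ1 : γ < 1)
    (hK : IsSubKernel K) {R : S → A → ℝ} {M : ℝ} (hR : ∀ s a, R s a ∈ Set.Icc 0 M)
    (h : IsOptimalPolicy γ K R π) {ι : ℝ} (hι : 0 < ι)
    (hgap : HasGap γ K R ι) (s₀ : S) (a₀ : A) :
    ∃ k ∈ Finset.range (⌊M / (1 - γ) / (ι / 2)⌋₊ + 1),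
      π = detPolicy (greedy γ (stopAt K s₀ a₀) (setReward R s₀ a₀ (k * (ι / 2)))) := by
  have h1γ : 0 < 1 - γ := by linarith
  have hM : 0 ≤ M := (hR s₀ a₀).1.trans (hR s₀ a₀).2
  set V := optValue γ K R with hV
  have hVeq : V = stateValue γ K R π := (h.stateValue_eq_optValue hγ0 hγ1 hK).symm
  have hV0 : ∀ s, 0 ≤ V s := fun s =>
    hVeq ▸ stateValue_nonneg hγ0 hγ1 hK h.1 (fun s a => (hR s a).1) s
  have hV1 : ∀ s, V s ≤ M / (1 - γ) := fun s =>
    hVeq ▸ stateValue_le_div hγ0 hγ1 hK h.1 hM (fun s a => (hR s a).2) s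
  have hq0 : 0 ≤ qValue γ K R V s₀ a₀ :=
    add_nonneg (hR s₀ a₀).1 (mul_nonneg hγ0 (hK.sum_mul_nonneg hV0 s₀ a₀))
  have hq1 : qValue γ K R V s₀ a₀ ≤ M / (1 - γ) :=
    ((isOptValue_optValue hγ0 hγ1 hK R s₀).1 a₀).trans (hV1 s₀)
  obtain ⟨k, hk, hkq⟩ := exists_nat_mul_near (half_pos hι) hq0 hq1
  exact ⟨k, hk, h.eq_greedy_stopAt hγ0 hγ1 hK hι hgap s₀ a₀ hkq⟩

end Stopping

/-! ### A linearized Bernstein inequality for the empirical kernel -/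

section Bernstein

variable {S : Type*} [Fintype S] [MeasurableSpace S] [DiscreteMeasurableSpace S]

theorem isProbabilityMeasure_weightMeasure {p : S → ℝ} (hp : p ∈ stdSimplex ℝ S) :
    IsProbabilityMeasure (weightMeasure p) := by
  constructor
  simp only [weightMeasure, Measure.coe_finsetSum, Finset.sum_apply, Measure.smul_apply,
    measure_univ, smul_eq_mul, mul_one]
  rw [← ENNReal.ofReal_sum_of_nonneg fun s _ => hp.1 s, hp.2, ENNReal.ofReal_one]

theorem integral_weightMeasure {p : S → ℝ} (hp : ∀ s, 0 ≤ p s) (g : S → ℝ) :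
    ∫ s, g s ∂weightMeasure p = ∑ s, p s * g s := by
  rw [weightMeasure, integral_finsetSum_measure fun s _ => ?_]
  · refine Finset.sum_congr rfl fun s _ => ?_
    rw [integral_smul_measure, integral_dirac, ENNReal.toReal_ofReal (hp s), smul_eq_mul]
  · exact (integrable_dirac (by simp)).smul_measure ENNReal.ofReal_ne_top

theorem sum_mul_exp_le {p : S → ℝ} (hp : p ∈ stdSimplex ℝ S) {f : S → ℝ} {θ : ℝ}
    (hθ : ∀ s, |θ * (f s - ∑ s, p s * f s)| ≤ 1) :
    ∑ s, p s * Real.exp (θ * (f s - ∑ s, p s * f s)) ≤ Real.exp (θ ^ 2 * weightVar p f) := by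
  set m := ∑ s, p s * f s with hm
  calc ∑ s, p s * Real.exp (θ * (f s - m))
      ≤ ∑ s, p s * (1 + θ * (f s - m) + (θ * (f s - m)) ^ 2) := by
        refine Finset.sum_le_sum fun s _ => mul_le_mul_of_nonneg_left ?_ (hp.1 s)
        have := (abs_le.1 (Real.abs_exp_sub_one_sub_id_le (hθ s))).2
        linarith
    _ = 1 + θ ^ 2 * weightVar p f := by
        have h : ∀ s, p s * (1 + θ * (f s - m) + (θ * (f s - m)) ^ 2) =
            p s + θ * (p s * f s) - θ * m * p s + θ ^ 2 * (p s * (f s - m) ^ 2) := fun s => by ring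
        rw [weightVar_eq_sum_sq_sub hp f m]
        simp only [h, Finset.sum_add_distrib, Finset.sum_sub_distrib, ← Finset.mul_sum, hp.2, ← hm]
        ring
    _ ≤ Real.exp (θ ^ 2 * weightVar p f) := by
        linarith [Real.add_one_le_exp (θ ^ 2 * weightVar p f)]

theorem measure_le_sum_le {ι : Type*} [Fintype ι] {p : S → ℝ} (hp : p ∈ stdSimplex ℝ S)
    {μ : ι → Measure S} (hμ : ∀ i, μ i = weightMeasure p) {f : S → ℝ} {θ : ℝ} (hθ0 : 0 < θ)
    (hθ : ∀ s, |θ * (f s - ∑ s, p s * f s)| ≤ 1) (ℓ : ℝ) :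
    Measure.pi μ {y | Fintype.card ι * (θ * weightVar p f) + ℓ / θ ≤
      ∑ i, (f (y i) - ∑ s, p s * f s)} ≤ ENNReal.ofReal (Real.exp (-ℓ)) := by
  set m := ∑ s, p s * f s with hm
  have hprob : ∀ i, IsProbabilityMeasure (μ i) := fun i => by
    rw [hμ i]; exact isProbabilityMeasure_weightMeasure hp
  have h1 := ProbabilityTheory.measure_ge_le_exp_mul_mgf (μ := Measure.pi μ)
    (X := fun y => ∑ i, (f (y i) - m)) (Fintype.card ι * (θ * weightVar p f) + ℓ / θ) hθ0.le
    Integrable.of_finite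
  have h2 : ProbabilityTheory.mgf (fun y : ι → S => ∑ i, (f (y i) - m)) (Measure.pi μ) θ ≤
      Real.exp (θ ^ 2 * weightVar p f) ^ Fintype.card ι := by
    have h3 : ∀ y : ι → S, Real.exp (θ * ∑ i, (f (y i) - m)) =
        ∏ i, Real.exp (θ * (f (y i) - m)) := fun y => by
      rw [Finset.mul_sum, Real.exp_sum]
    simp only [ProbabilityTheory.mgf, h3]
    rw [integral_fintype_prod_eq_prod (f := fun _ s => Real.exp (θ * (f s - m)))]
    simp only [hμ, integral_weightMeasure hp.1, Finset.prod_const, Finset.card_univ]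
    exact pow_le_pow_left₀ (Finset.sum_nonneg fun s _ => mul_nonneg (hp.1 s) (Real.exp_nonneg _))
      (sum_mul_exp_le hp hθ) _
  rw [← ENNReal.ofReal_toReal (measure_ne_top (Measure.pi μ) _)]
  refine ENNReal.ofReal_le_ofReal (h1.trans ?_)
  calc _ ≤ Real.exp (-θ * (Fintype.card ι * (θ * weightVar p f) + ℓ / θ)) *
          Real.exp (θ ^ 2 * weightVar p f) ^ Fintype.card ι :=
        mul_le_mul_of_nonneg_left h2 (Real.exp_nonneg _)
    _ = Real.exp (-ℓ) := by
        rw [← Real.exp_nat_mul, ← Real.exp_add]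
        congr 1
        field_simp
        ring

/-- Bernstein's inequality in linearized form: instead of optimizing over the exponent `θ`, the
standard deviation is replaced by a multiple of the variance. -/
theorem measure_le_abs_sum_le {ι : Type*} [Fintype ι] {p : S → ℝ} (hp : p ∈ stdSimplex ℝ S)
    {μ : ι → Measure S} (hμ : ∀ i, μ i = weightMeasure p) {f : S → ℝ} {θ : ℝ} (hθ0 : 0 < θ)
    (hθ : ∀ s, |θ * (f s - ∑ s, p s * f s)| ≤ 1) (ℓ : ℝ) :
    Measure.pi μ {y | Fintype.card ι * (θ * weightVar p f) + ℓ / θ ≤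
      |∑ i, (f (y i) - ∑ s, p s * f s)|} ≤ ENNReal.ofReal (2 * Real.exp (-ℓ)) := by
  have h1 := measure_le_sum_le hp hμ hθ0 hθ ℓ
  have hneg : ∑ s, p s * (-f s) = -∑ s, p s * f s := by simp
  have hvar : weightVar p (fun s => -f s) = weightVar p f := by simp [weightVar]
  have h2 := measure_le_sum_le (f := fun s => -f s) hp hμ hθ0 (fun s => by
    rw [hneg, ← abs_neg]
    convert hθ s using 2
    ring) ℓ
  rw [hvar, hneg] at h2
  rw [two_mul, ENNReal.ofReal_add (Real.exp_nonneg _) (Real.exp_nonneg _)]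
  refine le_trans (measure_mono ?_) ((measure_union_le _ _).trans (add_le_add h1 h2))
  intro y hy
  simp only [Set.mem_ofPred_eq] at hy
  rcases le_abs.1 hy with h | h
  · exact Or.inl h
  · refine Or.inr ?_
    simp only [Set.mem_ofPred_eq]
    refine h.trans_eq ?_
    rw [← Finset.sum_neg_distrib]
    exact Finset.sum_congr rfl fun i _ => by ring

end Bernstein

section Empirical

variable {S A : Type*} [Fintype S] [Fintype A] {N : ℕ}

theorem sum_empiricalP_mul (D : Data S A N) (s : S) (a : A) (f : S → ℝ) :
    ∑ s', empiricalP D s a s' * f s' = (∑ j, f (D.1 (s, a, j))) / N := by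
  classical
  have h : ∀ s', (((Finset.univ.filter fun j : Fin N => D.1 (s, a, j) = s').card : ℕ) : ℝ) * f s' =
      ∑ j, if D.1 (s, a, j) = s' then f s' else 0 := by
    intro s'
    rw [Finset.sum_ite, Finset.sum_const_zero, add_zero, Finset.sum_const, nsmul_eq_mul]
  have h2 : ∀ s', empiricalP D s a s' * f s' =
      (∑ j, if D.1 (s, a, j) = s' then f s' else 0) / N := by
    intro s'
    rw [← h s', empiricalP, div_mul_eq_mul_div]
  simp only [h2, ← Finset.sum_div]
  rw [Finset.sum_comm]
  simp

theorem empiricalP_mem_stdSimplex (hN : 0 < N) (D : Data S A N) (s : S) (a : A) :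
    empiricalP D s a ∈ stdSimplex ℝ S := by
  refine ⟨fun s' => by unfold empiricalP; positivity, ?_⟩
  have := sum_empiricalP_mul D s a fun _ => 1
  simp only [mul_one, Finset.sum_const, Finset.card_univ, Fintype.card_fin, nsmul_eq_mul] at this
  rw [this, div_self (by positivity)]

variable [MeasurableSpace S] [DiscreteMeasurableSpace S]

/-- The empirical row at `(s₀, a₀)` satisfies the linearized Bernstein inequality for a function `F`
computed from the other samples only. -/
theorem measure_not_concentrated_le {P : S → A → S → ℝ} (hP : ∀ s a, P s a ∈ stdSimplex ℝ S)
    (hN : 0 < N) (s₀ : S) (a₀ : A) (ξ : S × A → ℝ) (F : (S × A × Fin N → S) → S → ℝ)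
    (hF : ∀ x y, (∀ q, ¬(q.1 = s₀ ∧ q.2.1 = a₀) → x q = y q) → F x = F y) {B θ β ℓ : ℝ}
    (hB : ∀ x s, F x s ∈ Set.Icc 0 B) (hθ0 : 0 < θ) (hθB : θ * B ≤ 1) (hβ : ℓ / (N * θ) ≤ β) :
    Measure.pi (fun q : S × A × Fin N => weightMeasure (P q.1 q.2.1))
      {x | ¬Concentrated θ β (empiricalP ((x, ξ) : Data S A N) s₀ a₀) (P s₀ a₀) (F x)} ≤
      ENNReal.ofReal (2 * Real.exp (-ℓ)) := by
  classical
  have hprob : ∀ q : S × A × Fin N, IsProbabilityMeasure (weightMeasure (P q.1 q.2.1)) :=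
    fun q => isProbabilityMeasure_weightMeasure (hP _ _)
  set bad : Set (S × A × Fin N → S) :=
    {x | ¬Concentrated θ β (empiricalP ((x, ξ) : Data S A N) s₀ a₀) (P s₀ a₀) (F x)} with hbad
  have hmeas : MeasurableSet bad := Set.Finite.measurableSet (Set.toFinite _)
  set I : Finset (S × A × Fin N) := Finset.univ.filter fun q => q.1 = s₀ ∧ q.2.1 = a₀ with hI
  have hmem : ∀ q, q ∈ I ↔ q.1 = s₀ ∧ q.2.1 = a₀ := fun q => by simp [hI]
  let e : Fin N → I := fun j => ⟨(s₀, a₀, j), by simp [hI]⟩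
  have he : Function.Bijective e := by
    refine ⟨fun i j hij => ?_, fun ⟨⟨s, a, j⟩, hq⟩ => ⟨j, ?_⟩⟩
    · simpa [e] using hij
    · obtain ⟨rfl, rfl⟩ := (hmem _).1 hq
      rfl
  have hcard : Fintype.card I = N := by
    rw [← Fintype.card_of_bijective he, Fintype.card_fin]
  rw [← lintegral_indicator_one hmeas]
  refine le_trans (lintegral_le_of_lmarginal_le I (measurable_one.indicator hmeas)
    (g := fun _ => ENNReal.ofReal (2 * Real.exp (-ℓ))) measurable_const ?_)
    (by rw [lintegral_const, measure_univ, mul_one])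
  intro x
  simp only [lmarginal, lintegral_const, measure_univ, mul_one]
  have hFx : ∀ y : I → S, F (Function.updateFinset x I y) = F x := fun y =>
    hF _ _ fun q hq => by
      rw [Function.updateFinset_def]
      simp [hmem, hq]
  set m := ∑ s, P s₀ a₀ s * F x s with hm
  have hm0 : m ∈ Set.Icc 0 B :=
    ⟨le_sum_mul_of_le (hP s₀ a₀) fun s => (hB x s).1,
      sum_mul_le_of_le (hP s₀ a₀) fun s => (hB x s).2⟩
  have hbern := measure_le_abs_sum_le (hP s₀ a₀)
    (μ := fun i : I => weightMeasure (P i.1.1 i.1.2.1))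
    (fun i => by rw [((hmem _).1 i.2).1, ((hmem _).1 i.2).2]) (f := F x) hθ0 (fun s => by
      rw [abs_mul, abs_of_pos hθ0]
      refine le_trans (mul_le_mul_of_nonneg_left ?_ hθ0.le) hθB
      rw [abs_le]
      have := hB x s
      constructor <;> linarith [this.1, this.2, hm0.1, hm0.2]) ℓ
  rw [← hm] at hbern
  have hpre : (fun y : I → S => bad.indicator (1 : (S × A × Fin N → S) → ENNReal)
      (Function.updateFinset x I y)) =
      ((fun y => Function.updateFinset x I y) ⁻¹' bad).indicator 1 := rfl
  rw [hpre, lintegral_indicator_one (Set.Finite.measurableSet (Set.toFinite _))]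
  refine le_trans (measure_mono fun y hy => ?_) hbern
  simp only [Set.mem_preimage, hbad, Set.mem_ofPred_eq, hFx, Concentrated, not_le,
    sum_empiricalP_mul, ← hm] at hy
  have hsum : ∑ j, F x (Function.updateFinset x I y (s₀, a₀, j)) = ∑ i, F x (y i) := by
    refine Fintype.sum_bijective e he _ _ fun j => ?_
    rw [Function.updateFinset_def]
    simp [hI, e]
  have hN' : (0 : ℝ) < N := by exact_mod_cast hN
  rw [hsum] at hy
  simp only [Set.mem_ofPred_eq, hcard]
  rw [Finset.sum_sub_distrib, Finset.sum_const, Finset.card_univ, hcard, nsmul_eq_mul]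
  have h1 : (∑ i, F x (y i)) - N * m = N * ((∑ i, F x (y i)) / N - m) := by
    field_simp
  rw [h1, abs_mul, abs_of_pos hN']
  have h2 : N * (θ * weightVar (P s₀ a₀) (F x)) + ℓ / θ =
      N * (θ * weightVar (P s₀ a₀) (F x) + ℓ / (N * θ)) := by
    field_simp
  rw [h2]
  refine mul_le_mul_of_nonneg_left ?_ hN'.le
  linarith

end Empirical

/-! ### Random rewards create a gap -/

section Gap

variable {S A : Type*} [Fintype S] [Fintype A] [Nonempty A] {γ : ℝ} {K : S → A → S → ℝ}

/-- The reward `R` perturbed by `ξ`. -/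
def addNoise {S A : Type*} (R : S → A → ℝ) (ξ : S × A → ℝ) (s : S) (a : A) : ℝ :=
  R s a + ξ (s, a)

theorem continuous_optValue (hγ0 : 0 ≤ γ) (hγ1 : γ < 1) (hK : IsSubKernel K) (s : S) :
    Continuous fun R : S → A → ℝ => optValue γ K R s := by
  have h1γ : 0 < 1 - γ := by linarith
  have hle : ∀ R R' : S → A → ℝ, optValue γ K R' s - optValue γ K R s ≤
      (1 - γ)⁻¹ * dist R R' := by
    intro R R'
    refine (isOptValue_optValue hγ0 hγ1 hK R).sub_le hγ0 hγ1 hK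
      (isOptValue_optValue hγ0 hγ1 hK R') (fun s a => ?_) s
    have h1 : |R s a - R' s a| ≤ dist R R' :=
      (dist_le_pi_dist (R s) (R' s) a).trans (dist_le_pi_dist R R' s)
    have h2 : 1 - γ ≤ 1 - γ * ∑ s', K s a s' := by
      linarith [mul_le_mul_of_nonneg_left (hK.sum_le_one s a) hγ0]
    calc R' s a - R s a ≤ dist R R' := by linarith [(abs_le.1 h1).1]
      _ = (1 - γ)⁻¹ * dist R R' * (1 - γ) := by field_simp
      _ ≤ _ := mul_le_mul_of_nonneg_left h2 (by positivity)
  refine (LipschitzWith.of_dist_le_mul (K := ⟨(1 - γ)⁻¹, by positivity⟩) fun R R' => ?_).continuous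
  rw [Real.dist_eq, abs_le]
  have h1 := hle R R'
  have h2 := hle R' R
  rw [dist_comm R' R] at h2
  constructor
  · change -((1 - γ)⁻¹ * dist R R') ≤ _
    linarith
  · exact h2

theorem measurable_optValue (hγ0 : 0 ≤ γ) (hγ1 : γ < 1) (hK : IsSubKernel K)
    (R : (S × A → ℝ) → S → A → ℝ) (hR : ∀ s a, Continuous fun ξ => R ξ s a) (s : S) :
    Measurable fun ξ => optValue γ K (R ξ) s :=
  ((continuous_optValue hγ0 hγ1 hK s).comp
    (continuous_pi fun s => continuous_pi fun a => hR s a)).measurable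

theorem measurable_qValue_optValue (hγ0 : 0 ≤ γ) (hγ1 : γ < 1) (hK : IsSubKernel K)
    (R : (S × A → ℝ) → S → A → ℝ) (hR : ∀ s a, Continuous fun ξ => R ξ s a) (s : S) (a : A) :
    Measurable fun ξ => qValue γ K (R ξ) (optValue γ K (R ξ)) s a :=
  (hR s a).measurable.add (measurable_const.mul (Finset.measurable_sum _ fun s' _ =>
    measurable_const.mul (measurable_optValue hγ0 hγ1 hK R hR s')))

/-- The perturbations under which `a` is optimal in `s`, with another action less than `ι` behind. -/
def gapFailure (γ : ℝ) (K : S → A → S → ℝ) (R : S → A → ℝ) (ι : ℝ) (s : S) (a : A) :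
    Set (S × A → ℝ) :=
  {ξ | qValue γ K (addNoise R ξ) (optValue γ K (addNoise R ξ)) s a =
      optValue γ K (addNoise R ξ) s ∧
    ∃ a' ≠ a, optValue γ K (addNoise R ξ) s <
      qValue γ K (addNoise R ξ) (optValue γ K (addNoise R ξ)) s a' + ι}

theorem continuous_addNoise_apply (R : S → A → ℝ) (s : S) (a : A) :
    Continuous fun ξ : S × A → ℝ => addNoise R ξ s a := by
  unfold addNoise; fun_prop

theorem measurableSet_gapFailure (hγ0 : 0 ≤ γ) (hγ1 : γ < 1) (hK : IsSubKernel K)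
    (R : S → A → ℝ) (ι : ℝ) (s : S) (a : A) : MeasurableSet (gapFailure γ K R ι s a) := by
  have hV := measurable_optValue hγ0 hγ1 hK (addNoise R) (continuous_addNoise_apply R) s
  have hQ := measurable_qValue_optValue hγ0 hγ1 hK (addNoise R) (continuous_addNoise_apply R) s
  refine (measurableSet_eq_fun (hQ a) hV).inter ?_
  have : {ξ : S × A → ℝ | ∃ a' ≠ a, optValue γ K (addNoise R ξ) s <
      qValue γ K (addNoise R ξ) (optValue γ K (addNoise R ξ)) s a' + ι} =
      ⋃ a', ⋃ (_ : a' ≠ a), {ξ | optValue γ K (addNoise R ξ) s <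
        qValue γ K (addNoise R ξ) (optValue γ K (addNoise R ξ)) s a' + ι} := by
    ext ξ; simp
  change MeasurableSet {ξ : S × A → ℝ | ∃ a' ≠ a, optValue γ K (addNoise R ξ) s <
      qValue γ K (addNoise R ξ) (optValue γ K (addNoise R ξ)) s a' + ι}
  rw [this]
  exact .iUnion fun a' => .iUnion fun _ => measurableSet_lt hV ((hQ a').add_const ι)

theorem hasGap_of_notMem_gapFailure (hγ0 : 0 ≤ γ) (hγ1 : γ < 1) (hK : IsSubKernel K)
    {R : S → A → ℝ} {ι : ℝ} {ξ : S × A → ℝ} (h : ∀ s a, ξ ∉ gapFailure γ K R ι s a) :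
    HasGap γ K (addNoise R ξ) ι := by
  intro s
  obtain ⟨a, ha⟩ := (isOptValue_optValue hγ0 hγ1 hK (addNoise R ξ) s).2
  refine ⟨a, fun a' ha' => ?_⟩
  by_contra! hlt
  exact h s a ⟨ha, a', ha', hlt⟩

/-- Raising the reward of the optimal pair `(s, a)` by `y - x` raises the value at `s` by at least
that much, and every other action value at `s` at most `γ` times as much. So the gap opens at rate
`1 - γ`, and it is below `ι` only on a short interval. -/
theorem sub_le_of_mem_gapFailure (hγ0 : 0 ≤ γ) (hγ1 : γ < 1) (hK : IsSubKernel K)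
    {R R' : S → A → ℝ} {ι h : ℝ} (hh : 0 < h) {s : S} {a : A} (hR : R' s a = R s a + h)
    (hne : ∀ s' a', (s', a') ≠ (s, a) → R' s' a' = R s' a')
    {V V' : S → ℝ} (hV : IsOptValue γ K R V) (hV' : IsOptValue γ K R' V')
    (ha : qValue γ K R V s a = V s) (hgap : ∃ a' ≠ a, V' s < qValue γ K R' V' s a' + ι) :
    h ≤ ι / (1 - γ) := by
  have h1γ : 0 < 1 - γ := by linarith
  have hmono : ∀ s', 0 ≤ V' s' - V s' := by
    intro s'
    have := hV'.sub_le hγ0 hγ1 hK hV (M := 0) (fun s' a' => by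
      by_cases heq : (s', a') = (s, a)
      · obtain ⟨rfl, rfl⟩ := Prod.mk.inj heq
        rw [hR]; linarith
      · rw [hne s' a' heq]; simp) s'
    linarith
  have hdiff : ∀ s' a', qValue γ K R' V' s' a' - qValue γ K R V s' a' =
      R' s' a' - R s' a' + γ * ∑ x, K s' a' x * (V' x - V x) := by
    intro s' a'
    simp only [qValue, mul_sub, Finset.sum_sub_distrib]
    ring
  have hs : h ≤ V' s - V s := by
    have h1 := hdiff s a
    have h2 := (hV' s).1 a
    have h3 := mul_nonneg hγ0 (hK.sum_mul_nonneg hmono s a)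
    rw [hR] at h1
    linarith
  -- the increase of the value is largest at `s`
  have hmax : ∀ s', V' s' - V s' ≤ V' s - V s := by
    have : Nonempty S := ⟨s⟩
    obtain ⟨x, hx⟩ := Finite.exists_max fun s' => V' s' - V s'
    suffices V' x - V x ≤ V' s - V s from fun s' => (hx s').trans this
    by_cases hxs : x = s
    · rw [hxs]
    · obtain ⟨a', ha'⟩ := (hV' x).2
      have h1 := hdiff x a'
      have h2 := (hV x).1 a'
      have h3 := mul_le_mul_of_nonneg_left (hK.sum_mul_le (hmono x) hx x a') hγ0
      rw [hne x a' (fun heq => hxs (Prod.mk.inj heq).1), sub_self, zero_add] at h1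
      nlinarith
  obtain ⟨a', ha', hlt⟩ := hgap
  have h1 := hdiff s a'
  have h2 := (hV s).1 a'
  have h3 := mul_le_mul_of_nonneg_left (hK.sum_mul_le (hmono s) hmax s a') hγ0
  rw [hne s a' (fun heq => ha' (Prod.mk.inj heq).2), sub_self, zero_add] at h1
  rw [le_div_iff₀ h1γ]
  nlinarith

theorem isProbabilityMeasure_uniform {ω : ℝ} (hω : 0 < ω) :
    IsProbabilityMeasure (ProbabilityTheory.cond (volume : Measure ℝ) (Set.Icc 0 ω)) :=
  ProbabilityTheory.cond_isProbabilityMeasure_of_finite (by simp [hω]) (by simp)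

theorem uniform_le_of_sub_le {ω : ℝ} (hω : 0 < ω) {T : Set ℝ} {c : ℝ}
    (hT : ∀ x ∈ T, ∀ y ∈ T, x < y → y - x ≤ c) (hc : 0 ≤ c) :
    ProbabilityTheory.cond (volume : Measure ℝ) (Set.Icc 0 ω) T ≤ ENNReal.ofReal (c / ω) := by
  rw [ProbabilityTheory.cond_apply measurableSet_Icc, Real.volume_Icc, sub_zero,
    ENNReal.ofReal_div_of_pos hω, ENNReal.div_eq_inv_mul]
  gcongr
  refine (measure_mono Set.inter_subset_right).trans ((Real.volume_le_diam T).trans ?_)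
  refine Metric.ediam_le fun x hx y hy => ?_
  rw [edist_dist, Real.dist_eq]
  refine ENNReal.ofReal_le_ofReal ?_
  rcases lt_trichotomy x y with h | rfl | h
  · rw [abs_sub_comm, abs_of_pos (by linarith)]; exact hT x hx y hy h
  · simpa using hc
  · rw [abs_of_pos (by linarith)]; exact hT y hy x hx h

theorem measure_gapFailure_le (hγ0 : 0 ≤ γ) (hγ1 : γ < 1) (hK : IsSubKernel K)
    (R : S → A → ℝ) {ι ω : ℝ} (hι : 0 < ι) (hω : 0 < ω) (s : S) (a : A) :
    Measure.pi (fun _ : S × A => ProbabilityTheory.cond volume (Set.Icc 0 ω))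
      (gapFailure γ K R ι s a) ≤ ENNReal.ofReal (ι / (1 - γ) / ω) := by
  classical
  have h1γ : 0 < 1 - γ := by linarith
  have := isProbabilityMeasure_uniform hω
  have hmeas := measurableSet_gapFailure hγ0 hγ1 hK R ι s a
  rw [← lintegral_indicator_one hmeas]
  refine le_trans (lintegral_le_of_lmarginal_le {(s, a)} (measurable_one.indicator hmeas)
    (g := fun _ => ENNReal.ofReal (ι / (1 - γ) / ω)) measurable_const ?_)
    (by rw [lintegral_const, measure_univ, mul_one])
  rw [lmarginal_singleton, lmarginal_singleton]
  intro ξ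
  simp only [lintegral_const, measure_univ, mul_one]
  have hpre : (fun x : ℝ => (gapFailure γ K R ι s a).indicator
      (1 : (S × A → ℝ) → ENNReal) (Function.update ξ (s, a) x)) =
      ((fun x => Function.update ξ (s, a) x) ⁻¹' gapFailure γ K R ι s a).indicator 1 := rfl
  rw [hpre, lintegral_indicator_one (measurable_update ξ hmeas)]
  refine uniform_le_of_sub_le hω (fun x hx y hy hxy => ?_) (by positivity)
  refine sub_le_of_mem_gapFailure (s := s) (a := a) hγ0 hγ1 hK (sub_pos.2 hxy) ?_
    (fun s' a' hne => ?_)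
    (isOptValue_optValue hγ0 hγ1 hK _) (isOptValue_optValue hγ0 hγ1 hK _) hx.1 hy.2
  · simp only [addNoise, Function.update_self]; ring
  · simp only [addNoise, Function.update_of_ne hne]

end Gap

/-! ### The event on which all relevant policies are evaluated accurately -/

section AccurateData

variable {S A : Type*} [Fintype S] [Fintype A] {d N : ℕ}

/-- The reward (index `none`) and the constraint rewards of the problem, as one family. -/
def CMDP.objective (M : CMDP S A d) : Option (Fin d) → S → A → ℝ
  | none => M.r
  | some i => M.c i

theorem CMDP.objective_mem (M : CMDP S A d) (o : Option (Fin d)) (s : S) (a : A) :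
    M.objective o s a ∈ Set.Icc (0 : ℝ) 1 := by
  cases o
  · exact M.r_mem s a
  · exact M.c_mem _ s a

/-- The reward `r + ∑ i, lam i * c i` of the Lagrangian. -/
def CMDP.lagrangian (M : CMDP S A d) (lam : Fin d → ℝ) (s : S) (a : A) : ℝ :=
  M.r s a + ∑ i, lam i * M.c i s a

theorem CMDP.addNoise_lagrangian (M : CMDP S A d) (lam : Fin d → ℝ) (D : Data S A N) :
    addNoise (M.lagrangian lam) D.2 =
      fun s a => perturbedReward M.r D s a + ∑ i, lam i * M.c i s a := by
  funext s a
  simp only [addNoise, CMDP.lagrangian, perturbedReward]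
  ring

/-- Data for which the fixed policy `π₀` and all policies that the algorithm may compute with
multipliers in `Λ` have nearly the same values under the empirical and the true kernel. -/
structure AccurateData (M : CMDP S A d) (ε ω : ℝ) (Λ : Set ℝ) (π₀ : S → A → ℝ)
    (D : Data S A N) : Prop where
  noise_mem : ∀ s a, D.2 (s, a) ∈ Set.Icc 0 ω
  fixed : ∀ o s, |stateValue M.γ (empiricalP D) (M.objective o) π₀ s -
    stateValue M.γ M.P (M.objective o) π₀ s| ≤ ε / 8
  optimal : ∀ lam : Fin d → ℝ, (∀ i, lam i ∈ Λ) → ∀ π,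
    IsOptimalPolicy M.γ (empiricalP D)
      (fun s a => perturbedReward M.r D s a + ∑ i, lam i * M.c i s a) π →
    ∀ o s, |stateValue M.γ (empiricalP D) (M.objective o) π s -
      stateValue M.γ M.P (M.objective o) π s| ≤ ε / 8

/-- The multipliers `k i * ε₁`. -/
def gridPoint {m : ℕ} (ε₁ : ℝ) (κ : Fin d → Fin (m + 1)) (i : Fin d) : ℝ :=
  (κ i : ℕ) * ε₁

/-- Candidates for the policies of interest that do not depend on the samples at `(s₀, a₀)`: the
fixed policy, and the greedy policies of the empirical process stopped at `(s₀, a₀)`, for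
multipliers on a grid and final rewards `k * h`. -/
def candidatePolicy [Nonempty A] (M : CMDP S A d) (π₀ : S → A → ℝ) {m n : ℕ} (ε₁ h : ℝ) (s₀ : S)
    (a₀ : A) (D : Data S A N) : Option ((Fin d → Fin (m + 1)) × Fin (n + 1)) → S → A → ℝ
  | none => π₀
  | some (κ, k) => detPolicy (greedy M.γ (stopAt (empiricalP D) s₀ a₀)
      (setReward (addNoise (M.lagrangian (gridPoint ε₁ κ)) D.2) s₀ a₀ ((k : ℕ) * h)))

/-- The data for which the empirical row at `(s₀, a₀)` violates the linearized Bernstein inequality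
for the stopped value of a candidate policy. -/
def concentrationFailure [Nonempty A] (M : CMDP S A d) (π₀ : S → A → ℝ) {m n : ℕ}
    (ε₁ h θ β : ℝ) (s₀ : S) (a₀ : A) (j : Option ((Fin d → Fin (m + 1)) × Fin (n + 1)))
    (o : Option (Fin d)) (q : ℝ) : Set (Data S A N) :=
  {D | ¬Concentrated θ β (empiricalP D s₀ a₀) (M.P s₀ a₀)
    (stopValue M.γ (empiricalP D) (M.objective o) (candidatePolicy M π₀ ε₁ h s₀ a₀ D j) s₀ a₀ q)}

theorem isPolicy_candidatePolicy [Nonempty A] (M : CMDP S A d) {π₀ : S → A → ℝ}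
    (hπ₀ : IsPolicy π₀) {m n : ℕ} (ε₁ h : ℝ) (s₀ : S) (a₀ : A) (D : Data S A N)
    (j : Option ((Fin d → Fin (m + 1)) × Fin (n + 1))) :
    IsPolicy (candidatePolicy M π₀ ε₁ h s₀ a₀ D j) := by
  rcases j with _ | ⟨κ, k⟩
  · exact hπ₀
  · exact isPolicy_detPolicy _

/-- If no row fails to concentrate and the empirical problem has a gap for all multipliers, the data
is accurate: for every row the policy at hand is one of the candidates. -/
theorem accurateData_of_notMem [Nonempty A] (M : CMDP S A d) {π₀ : S → A → ℝ}
    (hπ₀ : IsPolicy π₀) {ε ω ι ε₁ B : ℝ} (hε0 : 0 < ε) (hε1 : ε ≤ 1 / (1 - M.γ))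
    (hι : 0 < ι) (hε₁ : 0 ≤ ε₁) {m : ℕ} (hB : 1 + ω + d * (m * ε₁) ≤ B) {Λ : Set ℝ}
    (hΛ : ∀ x ∈ Λ, ∃ k < m + 1, x = (k : ℕ) * ε₁) (hN : 0 < N) (D : Data S A N)
    (hnoise : ∀ s a, D.2 (s, a) ∈ Set.Icc 0 ω)
    (hgap : ∀ (κ : Fin d → Fin (m + 1)) s a,
      D.2 ∉ gapFailure M.γ (empiricalP D) (M.lagrangian (gridPoint ε₁ κ)) ι s a)
    (hconc : ∀ s₀ a₀
      (j : Option ((Fin d → Fin (m + 1)) × Fin (⌊B / (1 - M.γ) / (ι / 2)⌋₊ + 1)))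
      (o : Option (Fin d)) (k : Fin (⌊1 / (1 - M.γ) / (ε * (1 - M.γ) / 256)⌋₊ + 1)),
      D ∉ concentrationFailure M π₀ ε₁ (ι / 2) ((1 - M.γ) ^ 2 * ε / 128) (ε * (1 - M.γ) / 64)
        s₀ a₀ j o ((k : ℕ) * (ε * (1 - M.γ) / 256))) :
    AccurateData M ε ω Λ π₀ D := by
  obtain ⟨hγ0, hγ1⟩ := M.γ_mem
  have hP' := empiricalP_mem_stdSimplex hN D
  have hK := isSubKernel_of_mem_stdSimplex hP'
  refine ⟨hnoise, fun o s => ?_, fun lam hlam π hπ o s => ?_⟩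
  · refine abs_stateValue_sub_le_of_rowConcentrated hγ0 hγ1 M.P_mem hP' hπ₀ (M.objective_mem o)
      hε0 hε1 (fun s₀ a₀ k hk => ?_) s
    have := hconc s₀ a₀ none o ⟨k, Finset.mem_range.1 hk⟩
    simpa [concentrationFailure, candidatePolicy] using this
  · choose κ hκ hlamκ using fun i => hΛ (lam i) (hlam i)
    have hlam' : lam = gridPoint ε₁ (fun i => (⟨κ i, hκ i⟩ : Fin (m + 1))) := by
      funext i
      simp [gridPoint, hlamκ i]
    rw [← M.addNoise_lagrangian lam D] at hπ
    have hR : ∀ s a, addNoise (M.lagrangian lam) D.2 s a ∈ Set.Icc 0 B := by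
      intro s a
      have h1 : ∀ i, lam i * M.c i s a ∈ Set.Icc 0 (m * ε₁) := by
        intro i
        have h2 : lam i ≤ m * ε₁ := by
          rw [hlamκ i]
          have : (κ i : ℝ) ≤ m := by exact_mod_cast Nat.lt_succ_iff.1 (hκ i)
          gcongr
        have h3 : 0 ≤ lam i := by rw [hlamκ i]; positivity
        have h4 := M.c_mem i s a
        exact ⟨mul_nonneg h3 h4.1, (mul_le_of_le_one_right h3 h4.2).trans h2⟩
      have h5 := Finset.sum_nonneg fun i (_ : i ∈ Finset.univ) => (h1 i).1
      have h6 := Finset.sum_le_sum fun i (_ : i ∈ Finset.univ) => (h1 i).2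
      rw [Finset.sum_const, Finset.card_univ, Fintype.card_fin, nsmul_eq_mul] at h6
      have h7 := M.r_mem s a
      have h8 := hnoise s a
      simp only [addNoise, CMDP.lagrangian]
      constructor <;> linarith [h7.1, h7.2, h8.1, h8.2]
    have hg : HasGap M.γ (empiricalP D) (addNoise (M.lagrangian lam) D.2) ι := by
      rw [hlam']
      exact hasGap_of_notMem_gapFailure hγ0 hγ1 hK (hgap _)
    refine abs_stateValue_sub_le_of_rowConcentrated hγ0 hγ1 M.P_mem hP' hπ.1 (M.objective_mem o)
      hε0 hε1 (fun s₀ a₀ k hk => ?_) s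
    obtain ⟨k', hk', hπk⟩ := hπ.exists_eq_greedy hγ0 hγ1 hK hR hι hg s₀ a₀
    have := hconc s₀ a₀ (some (fun i => ⟨κ i, hκ i⟩, ⟨k', Finset.mem_range.1 hk'⟩)) o
      ⟨k, Finset.mem_range.1 hk⟩
    rw [hπk, hlam']
    simpa [concentrationFailure, candidatePolicy] using this

variable [MeasurableSpace S] [DiscreteMeasurableSpace S]

theorem measurableSet_concentrationFailure [Nonempty A] (M : CMDP S A d) (π₀ : S → A → ℝ)
    {m n : ℕ} (ε₁ h θ β : ℝ) (hN : 0 < N) (s₀ : S) (a₀ : A)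
    (j : Option ((Fin d → Fin (m + 1)) × Fin (n + 1))) (o : Option (Fin d)) (q : ℝ) :
    MeasurableSet (concentrationFailure (N := N) M π₀ ε₁ h θ β s₀ a₀ j o q) := by
  obtain ⟨hγ0, hγ1⟩ := M.γ_mem
  refine measurableSet_setOfPred.2 (measurable_from_prod_countable_right fun x => ?_)
  refine measurableSet_setOfPred.1 ?_
  rcases j with _ | ⟨κ, k⟩
  · exact MeasurableSet.const (¬Concentrated θ β
      (empiricalP ((x, 0) : Data S A N) s₀ a₀) (M.P s₀ a₀)
      (stopValue M.γ (empiricalP ((x, 0) : Data S A N)) (M.objective o) π₀ s₀ a₀ q))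
  · -- the candidate policy depends on the perturbation only through the set of maximizing pairs
    set K := stopAt (empiricalP ((x, 0) : Data S A N)) s₀ a₀ with hK
    set R : (S × A → ℝ) → S → A → ℝ := fun ξ =>
      setReward (addNoise (M.lagrangian (gridPoint ε₁ κ)) ξ) s₀ a₀ ((k : ℕ) * h) with hR
    have hKs : IsSubKernel K :=
      (isSubKernel_of_mem_stdSimplex (empiricalP_mem_stdSimplex hN _)).stopAt s₀ a₀
    have hRc : ∀ s a, Continuous fun ξ => R ξ s a := by
      intro s a
      by_cases hs : s = s₀ ∧ a = a₀
      · simp only [hR, setReward, hs, and_self, if_true]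
        exact continuous_const
      · simp only [hR, setReward, hs, if_false]
        exact continuous_addNoise_apply _ s a
    let p : (S × A → ℝ) → S → A → Prop := fun ξ s a =>
      qValue M.γ K (R ξ) (optValue M.γ K (R ξ)) s a = optValue M.γ K (R ξ) s
    have hp : Measurable p := by
      refine measurable_pi_iff.2 fun s => measurable_pi_iff.2 fun a => ?_
      exact measurableSet_setOfPred.1 (measurableSet_eq_fun
        (measurable_qValue_optValue hγ0 hγ1 hKs R hRc s a)
        (measurable_optValue hγ0 hγ1 hKs R hRc s))
    exact hp (Set.Finite.measurableSet (Set.toFinite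
      {p : S → A → Prop | ¬Concentrated θ β (empiricalP ((x, 0) : Data S A N) s₀ a₀) (M.P s₀ a₀)
        (stopValue M.γ (empiricalP ((x, 0) : Data S A N)) (M.objective o)
          (detPolicy fun s => Classical.epsilon (p s)) s₀ a₀ q)}))

theorem isProbabilityMeasure_dataLaw (M : CMDP S A d) (N : ℕ) {ω : ℝ} (hω : 0 < ω) :
    IsProbabilityMeasure (M.dataLaw N ω) := by
  have h1 : ∀ q : S × A × Fin N, IsProbabilityMeasure (weightMeasure (M.P q.1 q.2.1)) :=
    fun q => isProbabilityMeasure_weightMeasure (M.P_mem _ _)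
  have h2 := isProbabilityMeasure_uniform hω
  unfold CMDP.dataLaw
  infer_instance

theorem dataLaw_concentrationFailure_le [Nonempty A] (M : CMDP S A d) {π₀ : S → A → ℝ}
    (hπ₀ : IsPolicy π₀) {m n : ℕ} {ε₁ h θ β ℓ ω : ℝ} (hN : 0 < N) (hω : 0 < ω) (s₀ : S) (a₀ : A)
    (j : Option ((Fin d → Fin (m + 1)) × Fin (n + 1))) (o : Option (Fin d)) {q : ℝ}
    (hq0 : 0 ≤ q) (hq1 : q ≤ 1 / (1 - M.γ)) (hθ0 : 0 < θ) (hθ1 : θ * (1 / (1 - M.γ)) ≤ 1)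
    (hβ : ℓ / (N * θ) ≤ β) :
    M.dataLaw N ω (concentrationFailure (N := N) M π₀ ε₁ h θ β s₀ a₀ j o q) ≤
      ENNReal.ofReal (2 * Real.exp (-ℓ)) := by
  obtain ⟨hγ0, hγ1⟩ := M.γ_mem
  have h1 : ∀ q : S × A × Fin N, IsProbabilityMeasure (weightMeasure (M.P q.1 q.2.1)) :=
    fun q => isProbabilityMeasure_weightMeasure (M.P_mem _ _)
  have h2 := isProbabilityMeasure_uniform hω
  rw [CMDP.dataLaw, Measure.prod_apply_symm
    (measurableSet_concentrationFailure M π₀ ε₁ h θ β hN s₀ a₀ j o q)]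
  refine (lintegral_mono (g := fun _ => ENNReal.ofReal (2 * Real.exp (-ℓ))) fun ξ => ?_).trans
    (by rw [lintegral_const, measure_univ, mul_one])
  refine measure_not_concentrated_le M.P_mem hN s₀ a₀ ξ
    (fun x => stopValue M.γ (empiricalP ((x, ξ) : Data S A N)) (M.objective o)
      (candidatePolicy M π₀ ε₁ h s₀ a₀ (x, ξ) j) s₀ a₀ q) (fun x y hxy => ?_)
    (fun x => stopValue_mem_Icc hγ0 hγ1
      (isSubKernel_of_mem_stdSimplex (empiricalP_mem_stdSimplex hN _))
      (isPolicy_candidatePolicy M hπ₀ ε₁ h s₀ a₀ _ j) (M.objective_mem o) s₀ a₀ hq0 hq1)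
    hθ0 hθ1 hβ
  have hkernel : stopAt (empiricalP ((x, ξ) : Data S A N)) s₀ a₀ =
      stopAt (empiricalP ((y, ξ) : Data S A N)) s₀ a₀ := by
    funext s a s'
    by_cases hs : s = s₀ ∧ a = a₀
    · simp [stopAt, hs]
    · have hrow : ∀ j, x (s, a, j) = y (s, a, j) := fun j => hxy (s, a, j) hs
      simp only [stopAt, hs, if_false, empiricalP]
      congr! 4 with j
      rw [hrow]
  have hpol : candidatePolicy M π₀ ε₁ h s₀ a₀ ((x, ξ) : Data S A N) j =
      candidatePolicy M π₀ ε₁ h s₀ a₀ ((y, ξ) : Data S A N) j := by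
    rcases j with _ | ⟨κ, k⟩
    · rfl
    · simp only [candidatePolicy, hkernel]
  simp only [stopValue, hkernel, hpol]

theorem measurableSet_data_gapFailure [Nonempty A] (M : CMDP S A d) (hN : 0 < N) (R : S → A → ℝ)
    (ι : ℝ) (s : S) (a : A) :
    MeasurableSet {D : Data S A N | D.2 ∈ gapFailure M.γ (empiricalP D) R ι s a} := by
  obtain ⟨hγ0, hγ1⟩ := M.γ_mem
  refine measurableSet_setOfPred.2 (measurable_from_prod_countable_right fun x => ?_)
  exact measurableSet_setOfPred.1 (measurableSet_gapFailure hγ0 hγ1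
    (isSubKernel_of_mem_stdSimplex (empiricalP_mem_stdSimplex hN ((x, 0) : Data S A N))) R ι s a)

theorem dataLaw_gapFailure_le [Nonempty A] (M : CMDP S A d) (hN : 0 < N) (R : S → A → ℝ)
    {ι ω : ℝ} (hι : 0 < ι) (hω : 0 < ω) (s : S) (a : A) :
    M.dataLaw N ω {D : Data S A N | D.2 ∈ gapFailure M.γ (empiricalP D) R ι s a} ≤
      ENNReal.ofReal (ι / (1 - M.γ) / ω) := by
  obtain ⟨hγ0, hγ1⟩ := M.γ_mem
  have h1 : ∀ q : S × A × Fin N, IsProbabilityMeasure (weightMeasure (M.P q.1 q.2.1)) :=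
    fun q => isProbabilityMeasure_weightMeasure (M.P_mem _ _)
  have h2 := isProbabilityMeasure_uniform hω
  rw [CMDP.dataLaw, Measure.prod_apply (measurableSet_data_gapFailure M hN R ι s a)]
  refine (lintegral_mono (g := fun _ => ENNReal.ofReal (ι / (1 - M.γ) / ω)) fun x => ?_).trans
    (by rw [lintegral_const, measure_univ, mul_one])
  exact measure_gapFailure_le hγ0 hγ1
    (isSubKernel_of_mem_stdSimplex (empiricalP_mem_stdSimplex hN ((x, 0) : Data S A N)))
    R hι hω s a

theorem measurableSet_noise_notMem (N : ℕ) (ω : ℝ) (s : S) (a : A) :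
    MeasurableSet {D : Data S A N | D.2 (s, a) ∉ Set.Icc 0 ω} :=
  ((measurable_pi_apply (s, a)).comp measurable_snd) measurableSet_Icc.compl

theorem dataLaw_noise_notMem (M : CMDP S A d) (N : ℕ) {ω : ℝ} (hω : 0 < ω) (s : S) (a : A) :
    M.dataLaw N ω {D : Data S A N | D.2 (s, a) ∉ Set.Icc 0 ω} = 0 := by
  have h1 : ∀ q : S × A × Fin N, IsProbabilityMeasure (weightMeasure (M.P q.1 q.2.1)) :=
    fun q => isProbabilityMeasure_weightMeasure (M.P_mem _ _)
  have h2 := isProbabilityMeasure_uniform hω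
  have h3 : (Measure.pi fun _ : S × A => ProbabilityTheory.cond (volume : Measure ℝ) (Set.Icc 0 ω))
      {ξ | ξ (s, a) ∉ Set.Icc 0 ω} = 0 := by
    have h4 := (measurePreserving_eval (fun _ : S × A =>
      ProbabilityTheory.cond (volume : Measure ℝ) (Set.Icc 0 ω)) (s, a)).measure_preimage
      (s := (Set.Icc 0 ω)ᶜ) measurableSet_Icc.compl.nullMeasurableSet
    refine h4.trans ?_
    rw [ProbabilityTheory.cond_apply measurableSet_Icc]
    simp
  have h5 : {D : Data S A N | D.2 (s, a) ∉ Set.Icc 0 ω} =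
      Set.univ ×ˢ {ξ | ξ (s, a) ∉ Set.Icc 0 ω} := by
    ext D; simp
  rw [h5, CMDP.dataLaw, Measure.prod_prod, h3, mul_zero]

theorem measure_iUnion_le_of_le {α ι : Type*} [MeasurableSpace α] [Fintype ι] {μ : Measure α}
    {f : ι → Set α} {x δ : ℝ} (h : ∀ i, μ (f i) ≤ ENNReal.ofReal x)
    (hδ : Fintype.card ι * x ≤ δ) : μ (⋃ i, f i) ≤ ENNReal.ofReal δ := by
  refine (measure_iUnion_fintype_le μ f).trans ?_
  refine (Finset.sum_le_sum fun i _ => h i).trans ?_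
  rw [Finset.sum_const, Finset.card_univ, nsmul_eq_mul, ← ENNReal.ofReal_natCast,
    ← ENNReal.ofReal_mul (by positivity)]
  exact ENNReal.ofReal_le_ofReal hδ

/-- Union bound over all failure events: a vanishing gap, a row that fails to concentrate, and the
null event of a perturbation outside `[0, ω]`. The rewards of the Lagrangians are bounded by `B`. -/
theorem exists_accurateData_event [Nonempty A] (M : CMDP S A d) {π₀ : S → A → ℝ}
    (hπ₀ : IsPolicy π₀) {ε ω ι ε₁ B ℓ δ : ℝ} (hε0 : 0 < ε) (hε1 : ε ≤ 1 / (1 - M.γ))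
    (hω : 0 < ω) (hι : 0 < ι) (hε₁ : 0 ≤ ε₁) {m : ℕ} (hB : 1 + ω + d * (m * ε₁) ≤ B) {Λ : Set ℝ}
    (hΛ : ∀ x ∈ Λ, ∃ k < m + 1, x = (k : ℕ) * ε₁) (hN : 0 < N) (hδ : 0 ≤ δ)
    (hℓ : ℓ / (N * ((1 - M.γ) ^ 2 * ε / 128)) ≤ ε * (1 - M.γ) / 64)
    (hgap : (Fintype.card S * Fintype.card A * (m + 1) ^ d : ℝ) * (ι / (1 - M.γ) / ω) ≤ δ)
    (hconc : (Fintype.card S * Fintype.card A *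
        ((m + 1) ^ d * (⌊B / (1 - M.γ) / (ι / 2)⌋₊ + 1) + 1) * (d + 1) *
        (⌊1 / (1 - M.γ) / (ε * (1 - M.γ) / 256)⌋₊ + 1) : ℝ) * (2 * Real.exp (-ℓ)) ≤ δ) :
    ∃ E : Set (Data S A N), MeasurableSet E ∧
      ENNReal.ofReal (1 - 3 * δ) ≤ M.dataLaw N ω E ∧
      ∀ D ∈ E, AccurateData M ε ω Λ π₀ D := by
  obtain ⟨hγ0, hγ1⟩ := M.γ_mem
  have h1γ : 0 < 1 - M.γ := by linarith
  have hprob := isProbabilityMeasure_dataLaw M N hω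
  set n := ⌊B / (1 - M.γ) / (ι / 2)⌋₊ with hn
  set n' := ⌊1 / (1 - M.γ) / (ε * (1 - M.γ) / 256)⌋₊ with hn'
  set η := ε * (1 - M.γ) / 256 with hη
  have hη0 : 0 < η := by positivity
  set bad₁ : Set (Data S A N) := ⋃ t : S × A × (Fin d → Fin (m + 1)),
    {D | D.2 ∈ gapFailure M.γ (empiricalP D) (M.lagrangian (gridPoint ε₁ t.2.2)) ι t.1 t.2.1}
    with hbad₁
  set bad₂ : Set (Data S A N) := ⋃ t : S × A × Option ((Fin d → Fin (m + 1)) × Fin (n + 1)) ×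
      Option (Fin d) × Fin (n' + 1),
    concentrationFailure M π₀ ε₁ (ι / 2) ((1 - M.γ) ^ 2 * ε / 128) (ε * (1 - M.γ) / 64)
      t.1 t.2.1 t.2.2.1 t.2.2.2.1 ((t.2.2.2.2 : ℕ) * η) with hbad₂
  set bad₃ : Set (Data S A N) := ⋃ t : S × A, {D | D.2 (t.1, t.2) ∉ Set.Icc 0 ω} with hbad₃
  have hm₁ : MeasurableSet bad₁ :=
    .iUnion fun t => measurableSet_data_gapFailure M hN _ ι _ _
  have hm₂ : MeasurableSet bad₂ :=
    .iUnion fun t => measurableSet_concentrationFailure M π₀ _ _ _ _ hN _ _ _ _ _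
  have hm₃ : MeasurableSet bad₃ := .iUnion fun t => measurableSet_noise_notMem N ω _ _
  have hμ₁ : M.dataLaw N ω bad₁ ≤ ENNReal.ofReal δ := by
    refine measure_iUnion_le_of_le (fun t => dataLaw_gapFailure_le M hN _ hι hω _ _) ?_
    simp only [Fintype.card_prod, Fintype.card_fun, Fintype.card_fin]
    push_cast
    rwa [← mul_assoc (Fintype.card S : ℝ)]
  have hμ₂ : M.dataLaw N ω bad₂ ≤ ENNReal.ofReal δ := by
    refine measure_iUnion_le_of_le (x := 2 * Real.exp (-ℓ)) (fun t => ?_) ?_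
    · refine dataLaw_concentrationFailure_le M hπ₀ hN hω _ _ _ _ (by positivity) ?_ (by positivity)
        ?_ hℓ
      · have h1 : ((t.2.2.2.2 : ℕ) : ℝ) ≤ 1 / (1 - M.γ) / η :=
          (Nat.cast_le.2 (Nat.lt_succ_iff.1 t.2.2.2.2.2)).trans
            (Nat.floor_le (by positivity))
        rwa [le_div_iff₀ hη0] at h1
      · rw [le_div_iff₀ h1γ] at hε1
        have : (1 - M.γ) ^ 2 * ε / 128 * (1 / (1 - M.γ)) = ε * (1 - M.γ) / 128 := by
          field_simp
        rw [this]
        linarith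
    · simp only [Fintype.card_prod, Fintype.card_fun, Fintype.card_fin, Fintype.card_option]
      push_cast
      simpa only [mul_assoc] using hconc
  have hμ₃ : M.dataLaw N ω bad₃ ≤ ENNReal.ofReal δ :=
    measure_iUnion_le_of_le (x := 0) (fun t => by
      rw [dataLaw_noise_notMem M N hω]; exact zero_le) (by simpa using hδ)
  refine ⟨(bad₁ ∪ bad₂ ∪ bad₃)ᶜ, ((hm₁.union hm₂).union hm₃).compl, ?_, fun D hD => ?_⟩
  · rw [prob_compl_eq_one_sub ((hm₁.union hm₂).union hm₃), ENNReal.ofReal_sub _ (by positivity),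
      ENNReal.ofReal_one]
    refine tsub_le_tsub_left ?_ _
    calc _ ≤ M.dataLaw N ω bad₁ + M.dataLaw N ω bad₂ + M.dataLaw N ω bad₃ :=
          (measure_union_le _ _).trans (add_le_add_left (measure_union_le _ _) _)
      _ ≤ ENNReal.ofReal δ + ENNReal.ofReal δ + ENNReal.ofReal δ := by gcongr
      _ = ENNReal.ofReal (3 * δ) := by
          rw [← ENNReal.ofReal_add hδ hδ, ← ENNReal.ofReal_add (by positivity) hδ]
          congr 1
          ring
  · simp only [Set.mem_compl_iff, Set.mem_union, not_or, hbad₁, hbad₂, hbad₃, Set.mem_iUnion,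
      not_exists] at hD
    obtain ⟨⟨h1, h2⟩, h3⟩ := hD
    exact accurateData_of_notMem M hπ₀ hε0 hε1 hι hε₁ hB hΛ hN D
      (fun s a => not_not.1 (h3 (s, a))) (fun κ s a => h1 (s, a, κ))
      (fun s₀ a₀ j o k => h2 (s₀, a₀, j, o, k))

end AccurateData

/-! ### The primal-dual iteration on the empirical problem -/

section DualNet

theorem finite_dualNet {ε₁ : ℝ} (hε₁ : 0 < ε₁) (U : ℝ) : (dualNet ε₁ U).Finite := by
  refine Set.Finite.union (Set.Finite.subset
    ((Set.finite_Iic ⌊U / ε₁⌋₊).image fun k : ℕ => (k : ℝ) * ε₁) ?_) (Set.finite_singleton U)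
  rintro x ⟨⟨k, rfl⟩, hk⟩
  exact ⟨k, Nat.le_floor (by rwa [le_div_iff₀ hε₁]), rfl⟩

theorem exists_isRounding {ε₁ : ℝ} (hε₁ : 0 < ε₁) (U x : ℝ) :
    ∃ y, IsRounding (dualNet ε₁ U) x y :=
  Set.exists_min_image (dualNet ε₁ U) (fun y => |x - y|) (finite_dualNet hε₁ U) ⟨U, Or.inr rfl⟩

theorem zero_mem_dualNet {ε₁ U : ℝ} (hU : 0 ≤ U) : 0 ∈ dualNet ε₁ U :=
  Or.inl ⟨⟨0, by simp⟩, hU⟩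

theorem mem_Icc_of_mem_dualNet {ε₁ U x : ℝ} (hε₁ : 0 ≤ ε₁) (hU : 0 ≤ U) (hx : x ∈ dualNet ε₁ U) :
    x ∈ Set.Icc 0 U := by
  rcases hx with ⟨⟨k, rfl⟩, hk⟩ | rfl
  · exact ⟨by positivity, hk⟩
  · exact ⟨hU, le_rfl⟩

theorem IsRounding.abs_sub_le {ε₁ U x y : ℝ} (hε₁ : 0 < ε₁) (hx : x ∈ Set.Icc 0 U)
    (h : IsRounding (dualNet ε₁ U) x y) : |x - y| ≤ ε₁ := by
  have h1 := Nat.floor_le (div_nonneg hx.1 hε₁.le)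
  have h2 := Nat.lt_floor_add_one (x / ε₁)
  rw [le_div_iff₀ hε₁] at h1
  rw [div_lt_iff₀ hε₁] at h2
  refine (h.2 (⌊x / ε₁⌋₊ * ε₁) (Or.inl ⟨⟨_, rfl⟩, h1.trans hx.2⟩)).trans ?_
  rw [abs_le]
  constructor <;> linarith

/-- The regret of projected gradient descent on `[0, U]` with errors of at most `ε₁` per step. -/
theorem sum_regret_le {U η ε₁ G : ℝ} (hU : 0 ≤ U) (hη : 0 < η) (hε₁ : 0 ≤ ε₁) {T : ℕ}
    {x g : ℕ → ℝ} (hx : ∀ t ≤ T, x t ∈ Set.Icc 0 U) (hg : ∀ t < T, |g t| ≤ G)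
    (hstep : ∀ t < T, |max 0 (min U (x t - η * g t)) - x (t + 1)| ≤ ε₁) {y : ℝ}
    (hy : y ∈ Set.Icc 0 U) :
    ∑ t ∈ Finset.range T, (x t - y) * g t ≤
      (U ^ 2 + T * (η ^ 2 * G ^ 2 + (2 * U * ε₁ + ε₁ ^ 2))) / (2 * η) := by
  have key : ∀ n ≤ T, 2 * η * ∑ t ∈ Finset.range n, (x t - y) * g t + (x n - y) ^ 2 ≤
      U ^ 2 + n * (η ^ 2 * G ^ 2 + (2 * U * ε₁ + ε₁ ^ 2)) := by
    intro n
    induction n with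
    | zero =>
      intro _
      have h0 := hx 0 (Nat.zero_le T)
      have : (x 0 - y) ^ 2 ≤ U ^ 2 :=
        sq_le_sq' (by linarith [h0.1, hy.2]) (by linarith [h0.2, hy.1])
      simpa using this
    | succ n ih =>
      intro hn
      have h1 := ih (by omega)
      have hxn := hx n (by omega)
      set z := max 0 (min U (x n - η * g n)) with hz
      have hz0 : 0 ≤ z := le_max_left _ _
      have hzU : z ≤ U := max_le hU (min_le_left _ _)
      have hproj : (z - y) ^ 2 ≤ (x n - η * g n - y) ^ 2 := by
        rw [sq_le_sq]
        rcases le_total (x n - η * g n) 0 with h | h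
        · have : z = 0 := by rw [hz, min_eq_right (h.trans hU), max_eq_left h]
          rw [this, abs_of_nonpos (by linarith [hy.1]), abs_of_nonpos (by linarith [hy.1])]
          linarith
        · rcases le_total U (x n - η * g n) with h' | h'
          · have : z = U := by rw [hz, min_eq_left h', max_eq_right hU]
            rw [this, abs_of_nonneg (by linarith [hy.2]), abs_of_nonneg (by linarith [hy.2])]
            linarith
          · have : z = x n - η * g n := by rw [hz, min_eq_right h', max_eq_right h]
            rw [this]
      have hround : (x (n + 1) - y) ^ 2 ≤ (z - y) ^ 2 + (2 * U * ε₁ + ε₁ ^ 2) := by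
        have h2 := hstep n (by omega)
        have h3 : |z - y| ≤ U := by
          rw [abs_le]; constructor <;> linarith [hy.1, hy.2]
        have h4 : |x (n + 1) - y| ≤ |z - y| + ε₁ := by
          have := abs_sub_le (x (n + 1)) z y
          rw [abs_sub_comm (x (n + 1)) z] at this
          linarith
        have h5 : |x (n + 1) - y| ^ 2 ≤ (|z - y| + ε₁) ^ 2 :=
          pow_le_pow_left₀ (abs_nonneg _) h4 2
        rw [sq_abs] at h5
        have h6 : |z - y| ^ 2 = (z - y) ^ 2 := sq_abs _
        nlinarith
      have hG : g n ^ 2 ≤ G ^ 2 := by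
        have := hg n (by omega)
        exact sq_le_sq' (by linarith [(abs_le.1 this).1]) (abs_le.1 this).2
      have hG' := mul_le_mul_of_nonneg_left hG (sq_nonneg η)
      rw [Finset.sum_range_succ]
      push_cast
      nlinarith
  have := key T le_rfl
  rw [le_div_iff₀ (by positivity)]
  nlinarith [sq_nonneg (x T - y)]

end DualNet

section Value

variable {S A : Type*} [Fintype S] [Fintype A] {γ : ℝ} {ρ : S → ℝ} {K : S → A → S → ℝ}
  {π : S → A → ℝ}

theorem value_nonneg (hγ0 : 0 ≤ γ) (hγ1 : γ < 1) (hρ : ρ ∈ stdSimplex ℝ S) (hK : IsSubKernel K)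
    (hπ : IsPolicy π) {l : S → A → ℝ} (hl : ∀ s a, 0 ≤ l s a) : 0 ≤ value γ ρ K l π :=
  le_sum_mul_of_le hρ (stateValue_nonneg hγ0 hγ1 hK hπ hl)

theorem value_le_div (hγ0 : 0 ≤ γ) (hγ1 : γ < 1) (hρ : ρ ∈ stdSimplex ℝ S) (hK : IsSubKernel K)
    (hπ : IsPolicy π) {l : S → A → ℝ} {B : ℝ} (hB : 0 ≤ B) (hl : ∀ s a, l s a ≤ B) :
    value γ ρ K l π ≤ B / (1 - γ) :=
  sum_mul_le_of_le hρ (stateValue_le_div hγ0 hγ1 hK hπ hB hl)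

theorem value_mono (hγ0 : 0 ≤ γ) (hγ1 : γ < 1) (hρ : ρ ∈ stdSimplex ℝ S) (hK : IsSubKernel K)
    (hπ : IsPolicy π) {l l' : S → A → ℝ} (hl : ∀ s a, l s a ≤ l' s a) :
    value γ ρ K l π ≤ value γ ρ K l' π :=
  Finset.sum_le_sum fun s _ =>
    mul_le_mul_of_nonneg_left (stateValue_mono hγ0 hγ1 hK hπ hl s) (hρ.1 s)

theorem value_le_add_div (hγ0 : 0 ≤ γ) (hγ1 : γ < 1) (hρ : ρ ∈ stdSimplex ℝ S)
    (hK : IsSubKernel K) (hπ : IsPolicy π) {l l' : S → A → ℝ} {B : ℝ} (hB : 0 ≤ B)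
    (hl : ∀ s a, l' s a ≤ l s a + B) : value γ ρ K l' π ≤ value γ ρ K l π + B / (1 - γ) := by
  have h1 : ∀ s, stateValue γ K l' π s ≤ stateValue γ K l π s + B / (1 - γ) := by
    intro s
    have h2 : stateValue γ K l' π s ≤ stateValue γ K (fun s a => l s a + 1 * B) π s :=
      stateValue_mono hγ0 hγ1 hK hπ (fun s a => by simpa using hl s a) s
    rw [stateValue_add_smul hγ0 hγ1 hK hπ l (fun _ _ => B) 1 s, one_mul] at h2
    have h3 := stateValue_le_div hγ0 hγ1 hK hπ hB (l := fun _ _ => B) (fun _ _ => le_rfl) s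
    linarith
  have h2 : ∑ s, ρ s * (stateValue γ K l' π s - stateValue γ K l π s) ≤ B / (1 - γ) :=
    sum_mul_le_of_le hρ fun s => by linarith [h1 s]
  simp only [mul_sub, Finset.sum_sub_distrib] at h2
  unfold value
  linarith

theorem value_lagrangian (hγ0 : 0 ≤ γ) (hγ1 : γ < 1) (ρ : S → ℝ) (hK : IsSubKernel K)
    (hπ : IsPolicy π) {d : ℕ} (l : S → A → ℝ) (c : Fin d → S → A → ℝ) (lam : Fin d → ℝ) :
    value γ ρ K (fun s a => l s a + ∑ i, lam i * c i s a) π =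
      value γ ρ K l π + ∑ i, lam i * value γ ρ K (c i) π := by
  simp only [value, stateValue_lagrangian hγ0 hγ1 hK hπ, mul_add, Finset.sum_add_distrib,
    Finset.mul_sum]
  rw [Finset.sum_comm]
  congr 1
  exact Finset.sum_congr rfl fun i _ => Finset.sum_congr rfl fun s _ => by ring

theorem abs_value_sub_le (hρ : ρ ∈ stdSimplex ℝ S) {K' : S → A → S → ℝ} {l : S → A → ℝ} {x : ℝ}
    (h : ∀ s, |stateValue γ K' l π s - stateValue γ K l π s| ≤ x) :
    |value γ ρ K' l π - value γ ρ K l π| ≤ x := by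
  unfold value
  rw [← Finset.sum_sub_distrib, abs_le]
  simp only [← mul_sub]
  exact ⟨le_sum_mul_of_le hρ fun s => (abs_le.1 (h s)).1,
    sum_mul_le_of_le hρ fun s => (abs_le.1 (h s)).2⟩

end Value

section Run

variable {S A : Type*} [Fintype S] [Fintype A] {d N : ℕ}

theorem CMDP.exists_isRun [Nonempty A] (M : CMDP S A d) (hN : 0 < N) (D : Data S A N)
    (b' : Fin d → ℝ) {U ε₁ : ℝ} (hε₁ : 0 < ε₁) (η : ℝ) (T : ℕ) :
    ∃ lam pol, M.IsRun D b' U ε₁ η T lam pol := by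
  obtain ⟨hγ0, hγ1⟩ := M.γ_mem
  have hK := isSubKernel_of_mem_stdSimplex (empiricalP_mem_stdSimplex hN D)
  choose opt hopt using fun lam : Fin d → ℝ => exists_isOptimalPolicy hγ0 hγ1 hK
    fun s a => perturbedReward M.r D s a + ∑ i, lam i * M.c i s a
  choose round hround using exists_isRounding hε₁ U
  let lam : ℕ → Fin d → ℝ := fun t => Nat.rec 0 (fun _ l i => round (max 0 (min U
    (l i - η * (value M.γ M.ρ (empiricalP D) (M.c i) (opt l) - b' i))))) t
  exact ⟨lam, fun t => opt (lam t), rfl, fun t _ => hopt (lam t), fun t _ i => hround _⟩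

variable {M : CMDP S A d} {D : Data S A N} {b' : Fin d → ℝ} {U ε₁ η : ℝ} {T : ℕ}
  {lam : ℕ → Fin d → ℝ} {pol : ℕ → S → A → ℝ} {π₀ : S → A → ℝ}

theorem CMDP.IsRun.mem_dualNet (h : M.IsRun D b' U ε₁ η T lam pol) (hU : 0 ≤ U) {t : ℕ}
    (ht : t ≤ T) (i : Fin d) : lam t i ∈ dualNet ε₁ U := by
  cases t with
  | zero => rw [h.init]; exact zero_mem_dualNet hU
  | succ t => exact (h.dual t ht i).1

/-- A constraint with level at most `0` is always satisfied, and its multiplier stays at `0`. -/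
theorem CMDP.IsRun.eq_zero (h : M.IsRun D b' U ε₁ η T lam pol) (hN : 0 < N) (hU : 0 ≤ U)
    (hη : 0 ≤ η) {i : Fin d} (hi : b' i ≤ 0) {t : ℕ} (ht : t ≤ T) : lam t i = 0 := by
  obtain ⟨hγ0, hγ1⟩ := M.γ_mem
  have hK := isSubKernel_of_mem_stdSimplex (empiricalP_mem_stdSimplex hN D)
  induction t with
  | zero => rw [h.init]; rfl
  | succ t ih =>
    have h0 := ih (by omega)
    have hd := h.dual t ht i
    have hv := value_nonneg hγ0 hγ1 M.ρ_mem hK (h.primal t ht).1 (fun s a => (M.c_mem i s a).1)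
    have hx : max 0 (min U (lam t i - η * (value M.γ M.ρ (empiricalP D) (M.c i) (pol t) - b' i)))
        = 0 := by
      refine max_eq_left ((min_le_right _ _).trans ?_)
      rw [h0, zero_sub, neg_nonpos]
      exact mul_nonneg hη (by linarith)
    rw [hx] at hd
    have := hd.2 0 (zero_mem_dualNet hU)
    simpa using this

/-- Summed primal optimality plus dual regret: the suboptimality of the iterates is bounded by any
fixed nonnegative combination `y` of their constraint slacks, up to the regret. -/
theorem CMDP.IsRun.sum_gap_le (h : M.IsRun D b' U ε₁ η T lam pol) (hN : 0 < N) (hU : 0 ≤ U)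
    (hε₁ : 0 < ε₁) (hη : 0 < η) (hπ₀ : IsPolicy π₀)
    (hfeas : ∀ i, b' i ≤ value M.γ M.ρ (empiricalP D) (M.c i) π₀) {y : Fin d → ℝ}
    (hy : ∀ i, y i ∈ Set.Icc 0 U) (hy0 : ∀ i, b' i ≤ 0 → y i = 0) :
    ∑ t ∈ Finset.range T, (value M.γ M.ρ (empiricalP D) (perturbedReward M.r D) π₀ -
        value M.γ M.ρ (empiricalP D) (perturbedReward M.r D) (pol t)) ≤
      ∑ i, y i * ∑ t ∈ Finset.range T, (value M.γ M.ρ (empiricalP D) (M.c i) (pol t) - b' i) +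
      d * ((U ^ 2 + T * (η ^ 2 * (1 / (1 - M.γ)) ^ 2 + (2 * U * ε₁ + ε₁ ^ 2))) / (2 * η)) := by
  obtain ⟨hγ0, hγ1⟩ := M.γ_mem
  have h1γ : 0 < 1 - M.γ := by linarith
  have hK := isSubKernel_of_mem_stdSimplex (empiricalP_mem_stdSimplex hN D)
  set Rg := (U ^ 2 + T * (η ^ 2 * (1 / (1 - M.γ)) ^ 2 + (2 * U * ε₁ + ε₁ ^ 2))) / (2 * η) with hRg
  have hRg0 : 0 ≤ Rg := by positivity
  set g : ℕ → Fin d → ℝ := fun t i => value M.γ M.ρ (empiricalP D) (M.c i) (pol t) - b' i with hg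
  have hreg : ∀ i, ∑ t ∈ Finset.range T, (lam t i - y i) * g t i ≤ Rg := by
    intro i
    rcases le_or_gt (b' i) 0 with hi | hi
    · rw [Finset.sum_eq_zero fun t ht => ?_]
      · exact hRg0
      · rw [h.eq_zero hN hU hη.le hi (Finset.mem_range.1 ht).le, hy0 i hi, sub_zero, zero_mul]
    · refine sum_regret_le hU hη hε₁.le (x := fun t => lam t i) (g := fun t => g t i)
        (fun t ht => mem_Icc_of_mem_dualNet hε₁.le hU (h.mem_dualNet hU ht i)) (fun t ht => ?_)
        (fun t ht => ?_) (hy i)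
      · have h1 := value_nonneg hγ0 hγ1 M.ρ_mem hK (h.primal t ht).1 fun s a => (M.c_mem i s a).1
        have h2 := value_le_div hγ0 hγ1 M.ρ_mem hK (h.primal t ht).1 zero_le_one
          fun s a => (M.c_mem i s a).2
        have h3 := (hfeas i).trans
          (value_le_div hγ0 hγ1 M.ρ_mem hK hπ₀ zero_le_one fun s a => (M.c_mem i s a).2)
        simp only [hg]
        rw [abs_le]
        constructor <;> linarith
      · exact (h.dual t ht i).abs_sub_le hε₁ ⟨le_max_left _ _, max_le hU (min_le_left _ _)⟩
  have hprimal : ∀ t ∈ Finset.range T,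
      value M.γ M.ρ (empiricalP D) (perturbedReward M.r D) π₀ -
        value M.γ M.ρ (empiricalP D) (perturbedReward M.r D) (pol t) ≤ ∑ i, lam t i * g t i := by
    intro t ht
    have ht' := Finset.mem_range.1 ht
    have hp := h.primal t ht'
    have h1 : value M.γ M.ρ (empiricalP D)
        (fun s a => perturbedReward M.r D s a + ∑ i, lam t i * M.c i s a) π₀ ≤
        value M.γ M.ρ (empiricalP D)
        (fun s a => perturbedReward M.r D s a + ∑ i, lam t i * M.c i s a) (pol t) :=
      Finset.sum_le_sum fun s _ => mul_le_mul_of_nonneg_left (hp.2 π₀ hπ₀ s) (M.ρ_mem.1 s)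
    rw [value_lagrangian hγ0 hγ1 M.ρ hK hπ₀, value_lagrangian hγ0 hγ1 M.ρ hK hp.1] at h1
    have h2 : ∑ i, lam t i * b' i ≤
        ∑ i, lam t i * value M.γ M.ρ (empiricalP D) (M.c i) π₀ :=
      Finset.sum_le_sum fun i _ => mul_le_mul_of_nonneg_left (hfeas i)
        (mem_Icc_of_mem_dualNet hε₁.le hU (h.mem_dualNet hU ht'.le i)).1
    simp only [hg, mul_sub, Finset.sum_sub_distrib]
    linarith
  refine (Finset.sum_le_sum hprimal).trans ?_
  have h3 : ∑ t ∈ Finset.range T, ∑ i, lam t i * g t i =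
      ∑ i, y i * ∑ t ∈ Finset.range T, g t i +
        ∑ i, ∑ t ∈ Finset.range T, (lam t i - y i) * g t i := by
    rw [Finset.sum_comm, ← Finset.sum_add_distrib]
    refine Finset.sum_congr rfl fun i _ => ?_
    rw [Finset.mul_sum, ← Finset.sum_add_distrib]
    exact Finset.sum_congr rfl fun t _ => by ring
  rw [h3]
  have h4 := Finset.sum_le_sum fun i (_ : i ∈ Finset.univ) => hreg i
  rw [Finset.sum_const, Finset.card_univ, Fintype.card_fin, nsmul_eq_mul] at h4
  exact add_le_add_right h4 _

/-- On accurate data every run returns a good mixture, if the regret per step is at most `ε / 4`. A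
violated constraint would, multiplied by `U`, outweigh the range `O(1 / (1 - γ))` of the reward
values. -/
theorem CMDP.IsRun.mixtureValue_ge [Nonempty A] {ε : ℝ}
    (h : M.IsRun D (fun i => M.b i - 3 * ε / 8) U ε₁ η T lam pol) (hN : 0 < N)
    (hε0 : 0 < ε) (hε1 : ε ≤ 1 / (1 - M.γ)) (hU : U = 4 / (ε * (1 - M.γ))) (hε₁ : 0 < ε₁)
    (hη : 0 < η) (hT : 0 < T) (hπ₀ : M.IsFeasible π₀)
    (hreg : d * ((U ^ 2 + T * (η ^ 2 * (1 / (1 - M.γ)) ^ 2 + (2 * U * ε₁ + ε₁ ^ 2))) / (2 * η)) ≤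
      T * (ε / 4))
    (hD : AccurateData M ε (ε * (1 - M.γ) / 8) (dualNet ε₁ U) π₀ D) :
    value M.γ M.ρ M.P M.r π₀ - 3 * ε / 4 ≤ M.mixtureValue M.r T pol ∧
    ∀ i, M.b i - ε ≤ M.mixtureValue (M.c i) T pol := by
  obtain ⟨hγ0, hγ1⟩ := M.γ_mem
  have h1γ : 0 < 1 - M.γ := by linarith
  have hU0 : 0 < U := by rw [hU]; positivity
  have hT' : (0 : ℝ) < T := by exact_mod_cast hT
  have hK := isSubKernel_of_mem_stdSimplex (empiricalP_mem_stdSimplex hN D)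
  have hKt := isSubKernel_of_mem_stdSimplex M.P_mem
  set ω := ε * (1 - M.γ) / 8 with hω
  have hω0 : 0 < ω := by positivity
  have hω1 : ω / (1 - M.γ) = ε / 8 := by rw [hω]; field_simp
  set v := fun l π => value M.γ M.ρ (empiricalP D) l π with hv
  set rp := perturbedReward M.r D with hrp
  have hfixed : ∀ o, |v (M.objective o) π₀ - value M.γ M.ρ M.P (M.objective o) π₀| ≤ ε / 8 :=
    fun o => abs_value_sub_le M.ρ_mem (hD.fixed o)
  have hacc : ∀ t ∈ Finset.range T, ∀ o,
      |v (M.objective o) (pol t) - value M.γ M.ρ M.P (M.objective o) (pol t)| ≤ ε / 8 :=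
    fun t ht o => abs_value_sub_le M.ρ_mem (hD.optimal (lam t)
      (fun i => h.mem_dualNet hU0.le (Finset.mem_range.1 ht).le i) (pol t)
      (h.primal t (Finset.mem_range.1 ht)) o)
  have hfeas : ∀ i, M.b i - 3 * ε / 8 ≤ v (M.c i) π₀ := by
    intro i
    have h1 : |v (M.c i) π₀ - value M.γ M.ρ M.P (M.c i) π₀| ≤ ε / 8 := hfixed (some i)
    have h2 := hπ₀.2 i
    linarith [(abs_le.1 h1).1]
  have hgap := fun y hy hy0 => h.sum_gap_le hN hU0.le hε₁ hη hπ₀.1 hfeas (y := y) hy hy0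
  -- the accuracy of the values of the iterates, summed over the run
  have hsum : ∀ o, ∑ t ∈ Finset.range T, v (M.objective o) (pol t) - T * (ε / 8) ≤
      ∑ t ∈ Finset.range T, value M.γ M.ρ M.P (M.objective o) (pol t) := by
    intro o
    have h1 := Finset.sum_le_sum fun t (ht : t ∈ Finset.range T) =>
      (show v (M.objective o) (pol t) - ε / 8 ≤ value M.γ M.ρ M.P (M.objective o) (pol t) by
        linarith [(abs_le.1 (hacc t ht o)).2])
    rwa [Finset.sum_sub_distrib, Finset.sum_const, Finset.card_range, nsmul_eq_mul] at h1
  refine ⟨?_, fun i => ?_⟩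
  · have h0 := hgap 0 (fun _ => ⟨le_rfl, hU0.le⟩) (fun _ _ => rfl)
    simp only [Pi.zero_apply, zero_mul, Finset.sum_const_zero, zero_add, Finset.sum_sub_distrib,
      Finset.sum_const, Finset.card_range, nsmul_eq_mul] at h0
    have h1 : |v M.r π₀ - value M.γ M.ρ M.P M.r π₀| ≤ ε / 8 := hfixed none
    have h2 : v M.r π₀ ≤ v rp π₀ := value_mono hγ0 hγ1 M.ρ_mem hK hπ₀.1 fun s a => by
      simp only [hrp, perturbedReward]; linarith [(hD.noise_mem s a).1]
    have h3 : ∑ t ∈ Finset.range T, v rp (pol t) - T * (ε / 8) ≤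
        ∑ t ∈ Finset.range T, v M.r (pol t) := by
      have h4 := Finset.sum_le_sum fun t (ht : t ∈ Finset.range T) =>
        (show v rp (pol t) - ε / 8 ≤ v M.r (pol t) by
          have := value_le_add_div hγ0 hγ1 M.ρ_mem hK (h.primal t (Finset.mem_range.1 ht)).1
            (l := M.r) (l' := rp) hω0.le (fun s a => by
              simp only [hrp, perturbedReward]; linarith [(hD.noise_mem s a).2])
          rw [hω1] at this
          simp only [hv]
          linarith)
      rwa [Finset.sum_sub_distrib, Finset.sum_const, Finset.card_range, nsmul_eq_mul] at h4
    have h5 : ∑ t ∈ Finset.range T, v M.r (pol t) - T * (ε / 8) ≤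
      ∑ t ∈ Finset.range T, value M.γ M.ρ M.P M.r (pol t) := hsum none
    have h6 : value M.γ M.ρ M.P M.r π₀ - ε / 8 ≤ v rp π₀ := by linarith [(abs_le.1 h1).1]
    have h7 := mul_le_mul_of_nonneg_left h6 hT'.le
    rw [CMDP.mixtureValue, one_div_mul_eq_div, le_div_iff₀ hT']
    simp only [hv] at h3 h5 h7
    nlinarith
  · have hterm : ∀ t ∈ Finset.range T, 0 ≤ value M.γ M.ρ M.P (M.c i) (pol t) := fun t ht =>
      value_nonneg hγ0 hγ1 M.ρ_mem hKt (h.primal t (Finset.mem_range.1 ht)).1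
        fun s a => (M.c_mem i s a).1
    rw [CMDP.mixtureValue, one_div_mul_eq_div, le_div_iff₀ hT']
    rcases le_or_gt (M.b i - 3 * ε / 8) 0 with hi | hi
    · have h1 := Finset.sum_nonneg hterm
      nlinarith
    · classical
      have h0 := hgap (Pi.single i U) (fun j => by
          by_cases hj : j = i
          · subst hj; simp [hU0.le]
          · simp [hj, hU0.le]) (fun j hj => by
          by_cases hji : j = i
          · subst hji; linarith
          · simp [hji])
      rw [Finset.sum_eq_single i (fun j _ hj => by simp [hj]) (by simp), Pi.single_eq_same] at h0
      have h1 : ∑ t ∈ Finset.range T, v (M.c i) (pol t) - T * (ε / 8) ≤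
        ∑ t ∈ Finset.range T, value M.γ M.ρ M.P (M.c i) (pol t) := hsum (some i)
      have hεγ : ε * (1 - M.γ) ≤ 1 := by rwa [le_div_iff₀ h1γ] at hε1
      -- the reward values lie in `[0, 9 / 8 / (1 - γ)]`
      have h2 : -(T * (9 / 8 / (1 - M.γ))) ≤ ∑ t ∈ Finset.range T, (v rp π₀ - v rp (pol t)) := by
        have h3 : 0 ≤ v rp π₀ := value_nonneg hγ0 hγ1 M.ρ_mem hK hπ₀.1 fun s a =>
          add_nonneg (M.r_mem s a).1 (hD.noise_mem s a).1
        have h4 := Finset.sum_le_sum fun t (ht : t ∈ Finset.range T) =>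
          (show -(9 / 8 / (1 - M.γ)) ≤ v rp π₀ - v rp (pol t) by
            have := value_le_div hγ0 hγ1 M.ρ_mem hK (h.primal t (Finset.mem_range.1 ht)).1
              (l := rp) (B := 9 / 8) (by norm_num) (fun s a => by
                have h5 := (M.r_mem s a).2
                have h6 := (hD.noise_mem s a).2
                simp only [hrp, perturbedReward]
                linarith)
            simp only [hv] at h3 ⊢
            linarith)
        rw [Finset.sum_const, Finset.card_range, nsmul_eq_mul] at h4
        linarith
      have h3 : ε / 4 ≤ 1 / 4 / (1 - M.γ) := by
        rw [le_div_iff₀ h1γ]; linarith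
      have h4 : U * (ε / 2) = 2 / (1 - M.γ) := by rw [hU]; field_simp; norm_num
      have h5 : 9 / 8 / (1 - M.γ) + 1 / 4 / (1 - M.γ) ≤ 2 / (1 - M.γ) := by
        rw [← add_div]; gcongr; norm_num
      have h6 : -(U * (T * (ε / 2))) ≤
          U * ∑ t ∈ Finset.range T, (v (M.c i) (pol t) - (M.b i - 3 * ε / 8)) := by
        have h7 := mul_le_mul_of_nonneg_left (h3.trans (le_sub_iff_add_le'.2 h5)) hT'.le
        have h8 : U * (T * (ε / 2)) = T * (2 / (1 - M.γ)) := by rw [← h4]; ring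
        rw [h8]
        simp only [hv] at h2 ⊢
        linarith
      have h7 : -(T * (ε / 2)) ≤
          ∑ t ∈ Finset.range T, (v (M.c i) (pol t) - (M.b i - 3 * ε / 8)) := by
        refine le_of_mul_le_mul_left ?_ hU0
        linarith
      rw [Finset.sum_sub_distrib, Finset.sum_const, Finset.card_range, nsmul_eq_mul] at h7
      simp only [hv] at h1 h7
      linarith

end Run

/-! ### Choice of the parameters -/

/-- With `n ≥ 32 d / (ε a) ^ 2` and `T = n ^ 2` steps the regret is at most `ε / 4` per step; the two
halves are due to the step size and to the rounding. Here `a = 1 - γ`. -/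
theorem regret_budget {a ε U ε₁ : ℝ} {d n m : ℕ} (ha0 : 0 < a) (hε0 : 0 < ε)
    (hd : 1 ≤ d) (hU : U = 4 / (ε * a)) (hn : 32 * ((d : ℝ) / (ε ^ 2 * a ^ 2)) ≤ n)
    (hm : 48 * ((d : ℝ) / (ε ^ 2 * a ^ 2)) * n ≤ m) (hn0 : 0 < n) (hm1 : 1 ≤ m)
    (hε₁ : ε₁ = U / m) :
    (d : ℝ) * ((U ^ 2 + (n ^ 2 : ℕ) * ((U * a / n) ^ 2 * (1 / a) ^ 2 + (2 * U * ε₁ + ε₁ ^ 2))) /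
      (2 * (U * a / n))) ≤ (n ^ 2 : ℕ) * (ε / 4) := by
  have hd' : (1 : ℝ) ≤ d := by exact_mod_cast hd
  have hn' : (0 : ℝ) < n := by exact_mod_cast hn0
  have hm' : (1 : ℝ) ≤ m := by exact_mod_cast hm1
  have hU0 : 0 < U := by rw [hU]; positivity
  have hε₁0 : 0 < ε₁ := by rw [hε₁]; positivity
  have hε₁U : ε₁ ≤ U := by rw [hε₁]; exact div_le_self hU0.le hm'
  have h1 : (d : ℝ) * U ≤ n * (ε * a / 8) := by
    rw [hU]
    have : (d : ℝ) * (4 / (ε * a)) = 32 * (d / (ε ^ 2 * a ^ 2)) * (ε * a / 8) := by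
      field_simp; norm_num
    rw [this]
    exact mul_le_mul_of_nonneg_right hn (by positivity)
  have h2 : (d : ℝ) * n * ε₁ ≤ ε * a / 12 := by
    rw [hε₁, hU, mul_div_assoc', div_le_iff₀ (by positivity)]
    have : (d : ℝ) * n * (4 / (ε * a)) = ε * a / 12 * (48 * (d / (ε ^ 2 * a ^ 2)) * n) := by
      field_simp; norm_num
    rw [this]
    exact mul_le_mul_of_nonneg_left hm (by positivity)
  have h3 : (d : ℝ) * ((U ^ 2 + (n ^ 2 : ℕ) * ((U * a / n) ^ 2 * (1 / a) ^ 2 +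
      (2 * U * ε₁ + ε₁ ^ 2))) / (2 * (U * a / n))) =
      d * U * n / a + d * n * ε₁ * n ^ 2 * (1 + ε₁ / (2 * U)) / a := by
    push_cast
    field_simp
    ring
  rw [h3]
  have h4 : d * U * n / a ≤ n ^ 2 * (ε / 8) := by
    rw [div_le_iff₀ ha0]
    calc d * U * n ≤ n * (ε * a / 8) * n := mul_le_mul_of_nonneg_right h1 hn'.le
      _ = n ^ 2 * (ε / 8) * a := by ring
  have h5 : d * n * ε₁ * n ^ 2 * (1 + ε₁ / (2 * U)) / a ≤ n ^ 2 * (ε / 8) := by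
    have h6 : ε₁ / (2 * U) ≤ 1 / 2 := by
      rw [div_le_iff₀ (by positivity)]; linarith
    rw [div_le_iff₀ ha0]
    calc d * n * ε₁ * n ^ 2 * (1 + ε₁ / (2 * U)) ≤ ε * a / 12 * n ^ 2 * (1 + 1 / 2) := by gcongr
      _ = n ^ 2 * (ε / 8) * a := by ring
  push_cast
  linarith

/-- The number of failure events is polynomial in `X` and `1 / δ`, apart from `Y`, the `d`-th power of
the size of the net; so its logarithm is of order `d * log X + log (1 / δ)`. -/
theorem union_budget {X Y δ s m a ε b dd : ℝ} {F G : ℕ} (hX : 1 ≤ X) (hY : 1 ≤ Y) (hδ0 : 0 < δ)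
    (hδ1 : δ < 1) (hs0 : 0 < s) (hs : s ≤ X) (hm0 : 0 ≤ m) (hm : m ≤ Y) (hdd0 : 0 ≤ dd)
    (hdd : dd ≤ X) (ha0 : 0 < a) (hε0 : 0 < ε) (ha : 1 / (ε * a ^ 3) ≤ X ^ 2)
    (hb : b ≤ 6 * X)
    (hF : (F : ℝ) ≤ b / a / (δ * a * (ε * a / 8) / (s * Y) / 2)) (hG : (G : ℝ) ≤ 256 * X)
    {ℓ : ℝ} (hℓ : 100744 * X ^ 7 * Y ^ 2 / δ ^ 2 ≤ Real.exp ℓ) :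
    s * (m * (F + 1) + 1) * (dd + 1) * (G + 1) * (2 * Real.exp (-ℓ)) ≤ δ := by
  have hF' : (F : ℝ) ≤ 96 * X ^ 4 * Y / δ := by
    refine hF.trans ?_
    have h1 : b / a / (δ * a * (ε * a / 8) / (s * Y) / 2) =
        16 * b * s * (1 / (ε * a ^ 3)) * Y / δ := by
      field_simp
      ring
    rw [h1]
    calc 16 * b * s * (1 / (ε * a ^ 3)) * Y / δ ≤ 16 * (6 * X) * X * X ^ 2 * Y / δ := by gcongr
      _ = 96 * X ^ 4 * Y / δ := by ring
  have hX4 : 1 ≤ X ^ 4 := one_le_pow₀ hX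
  have h1δ : 1 ≤ 1 / δ := by rw [le_div_iff₀ hδ0]; linarith
  have hXY : 1 ≤ X ^ 4 * Y / δ := by
    rw [le_div_iff₀ hδ0]
    nlinarith [mul_le_mul hX4 hY zero_le_one (by positivity)]
  have h2 : m * (F + 1) + 1 ≤ 98 * X ^ 4 * Y ^ 2 / δ := by
    have h3 : (F : ℝ) + 1 ≤ 97 * (X ^ 4 * Y / δ) := by
      have : 96 * X ^ 4 * Y / δ = 96 * (X ^ 4 * Y / δ) := by ring
      linarith
    calc m * (F + 1) + 1 ≤ Y * (97 * (X ^ 4 * Y / δ)) + Y * (X ^ 4 * Y / δ) := by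
          refine add_le_add (mul_le_mul hm h3 (by positivity) (by positivity)) ?_
          nlinarith
      _ = 98 * X ^ 4 * Y ^ 2 / δ := by ring
  have h4 : s * (m * (F + 1) + 1) * (dd + 1) * (G + 1) ≤ 50372 * X ^ 7 * Y ^ 2 / δ := by
    calc s * (m * (F + 1) + 1) * (dd + 1) * (G + 1)
        ≤ X * (98 * X ^ 4 * Y ^ 2 / δ) * (2 * X) * (257 * X) := by
          gcongr
          · linarith
          · linarith
      _ = 50372 * X ^ 7 * Y ^ 2 / δ := by ring
  have h5 : Real.exp (-ℓ) ≤ δ ^ 2 / (100744 * X ^ 7 * Y ^ 2) := by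
    rw [Real.exp_neg, inv_le_comm₀ (Real.exp_pos _) (by positivity), inv_div]
    exact hℓ
  calc _ ≤ 50372 * X ^ 7 * Y ^ 2 / δ * (2 * (δ ^ 2 / (100744 * X ^ 7 * Y ^ 2))) := by gcongr
    _ = δ := by field_simp; norm_num

theorem le_exp_budget {X δ : ℝ} {d : ℕ} (hX : 1 ≤ X) (hd : 1 ≤ d) (hδ0 : 0 < δ)
    (hδ : 1 ≤ Real.log (1 / δ)) :
    100744 * X ^ 7 * ((1618 * X ^ 4) ^ d) ^ 2 / δ ^ 2 ≤
      Real.exp (30 * (d * (1 + Real.log X) * Real.log (1 / δ))) := by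
  have hX0 : 0 < X := by linarith
  have hd' : (1 : ℝ) ≤ d := by exact_mod_cast hd
  have hlogX : 0 ≤ Real.log X := Real.log_nonneg hX
  rw [← Real.log_le_iff_le_exp (by positivity)]
  have h1 : Real.log (100744 * X ^ 7 * ((1618 * X ^ 4) ^ d) ^ 2 / δ ^ 2) =
      Real.log 100744 + 7 * Real.log X + 2 * (d * (Real.log 1618 + 4 * Real.log X)) +
        2 * Real.log (1 / δ) := by
    rw [Real.log_div (by positivity) (by positivity), Real.log_mul (by positivity) (by positivity),
      Real.log_mul (by positivity) (by positivity), Real.log_pow, Real.log_pow, Real.log_pow,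
      Real.log_pow, Real.log_mul (by positivity) (by positivity), Real.log_pow, one_div,
      Real.log_inv]
    push_cast
    ring
  have h2 : Real.log 100744 ≤ 12 := by
    have h3 : Real.log 100744 ≤ Real.log (2 ^ 17) := Real.log_le_log (by norm_num) (by norm_num)
    rw [Real.log_pow] at h3
    push_cast at h3
    linarith [Real.log_two_lt_d9]
  have h3 : Real.log 1618 ≤ 8 := by
    have h3 : Real.log 1618 ≤ Real.log (2 ^ 11) := Real.log_le_log (by norm_num) (by norm_num)
    rw [Real.log_pow] at h3
    push_cast at h3
    linarith [Real.log_two_lt_d9]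
  rw [h1]
  set x := Real.log X
  set y := Real.log (1 / δ)
  have h4 : 1 + x ≤ d * (1 + x) := le_mul_of_one_le_left (by linarith) hd'
  have h5 : d * (1 + x) ≤ d * (1 + x) * y := le_mul_of_one_le_right (by positivity) hδ
  have h6 : y ≤ d * (1 + x) * y := le_mul_of_one_le_left (by linarith) (by nlinarith)
  have h7 : d * (Real.log 1618 + 4 * x) ≤ d * (8 * (1 + x)) := by gcongr; linarith
  linarith

theorem exists_nat_mul_of_mem_dualNet {U ε₁ : ℝ} {m : ℕ} (hε₁ : 0 < ε₁)
    (hU : U = m * ε₁) {x : ℝ} (hx : x ∈ dualNet ε₁ U) : ∃ k < m + 1, x = (k : ℕ) * ε₁ := by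
  rcases hx with ⟨⟨k, rfl⟩, hk⟩ | rfl
  · refine ⟨k, Nat.lt_succ_iff.2 ?_, rfl⟩
    rw [hU] at hk
    exact_mod_cast le_of_mul_le_mul_right hk hε₁
  · exact ⟨m, Nat.lt_succ_self m, hU⟩

theorem CMDP.exists_isFeasible_optimalValue_lt {S A : Type*} [Fintype S] [Fintype A] {d : ℕ}
    (M : CMDP S A d) (h : ∃ π, M.IsFeasible π) {x : ℝ} (hx : x < M.optimalValue) :
    ∃ π, M.IsFeasible π ∧ x < value M.γ M.ρ M.P M.r π := by
  obtain ⟨π₁, hπ₁⟩ := h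
  obtain ⟨y, ⟨π, hπ, rfl⟩, hy⟩ := exists_lt_of_lt_csSup
    (s := {x | ∃ π, M.IsFeasible π ∧ x = value M.γ M.ρ M.P M.r π})
    ⟨_, π₁, hπ₁, rfl⟩ hx
  exact ⟨π, hπ, hy⟩

/-- The guarantee for one problem size and a confidence `δ ≤ 1 / e`, with explicit parameters. -/
theorem exists_event_of_le_samples {d : ℕ} {γ ε U ε₁ δ : ℝ} {n m : ℕ} (hd : 1 ≤ d)
    (hγ1 : γ < 1) (hγ0 : 0 ≤ γ) (hε0 : 0 < ε) (hε1 : ε ≤ 1 / (1 - γ))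
    (hU : U = 4 / (ε * (1 - γ))) (hn : 32 * ((d : ℝ) / (ε ^ 2 * (1 - γ) ^ 2)) ≤ n)
    (hm : 48 * ((d : ℝ) / (ε ^ 2 * (1 - γ) ^ 2)) * n ≤ m)
    (hm2 : (m : ℝ) ≤ 1617 * ((d : ℝ) / (ε ^ 2 * (1 - γ) ^ 2)) ^ 2) (hε₁ : ε₁ = U / m)
    (hδ0 : 0 < δ) (hδ1 : δ < 1) (hδ : 1 ≤ Real.log (1 / δ))
    {S : Type u} {A : Type v} [Fintype S] [Nonempty S] [MeasurableSpace S]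
    [DiscreteMeasurableSpace S] [Fintype A] [Nonempty A] {N : ℕ}
    (hN : 8192 * (30 * (d * (1 + Real.log (d * Fintype.card S * Fintype.card A /
      (ε * (1 - γ) ^ 2))) * Real.log (1 / δ))) / ((1 - γ) ^ 3 * ε ^ 2) ≤ N)
    (M : CMDP S A d) (hM : M.γ = γ) (hfeas : ∃ π, M.IsFeasible π) :
    ∃ E : Set (Data S A N), MeasurableSet E ∧
      ENNReal.ofReal (1 - 3 * δ) ≤ M.dataLaw N (ε * (1 - γ) / 8) E ∧
      ∀ D ∈ E,
        (∃ (lam : ℕ → Fin d → ℝ) (pol : ℕ → S → A → ℝ),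
          M.IsRun D (fun i => M.b i - 3 * ε / 8) U ε₁
            (U * (1 - γ) / Real.sqrt ((n ^ 2 : ℕ) : ℝ)) (n ^ 2) lam pol) ∧
        ∀ (lam : ℕ → Fin d → ℝ) (pol : ℕ → S → A → ℝ),
          M.IsRun D (fun i => M.b i - 3 * ε / 8) U ε₁
            (U * (1 - γ) / Real.sqrt ((n ^ 2 : ℕ) : ℝ)) (n ^ 2) lam pol →
          M.optimalValue - ε ≤ M.mixtureValue M.r (n ^ 2) pol ∧
          ∀ i, M.b i - ε ≤ M.mixtureValue (M.c i) (n ^ 2) pol := by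
  subst hM
  set a := 1 - M.γ with ha
  have ha0 : 0 < a := by linarith
  have ha1 : a ≤ 1 := by linarith
  have hεa : ε * a ≤ 1 := by rwa [le_div_iff₀ ha0] at hε1
  have hd' : (1 : ℝ) ≤ d := by exact_mod_cast hd
  set z := (d : ℝ) / (ε ^ 2 * a ^ 2) with hz
  have hz1 : 1 ≤ z := by
    rw [hz, le_div_iff₀ (by positivity), one_mul, ← mul_pow]
    exact (pow_le_one₀ (by positivity) hεa).trans hd'
  have hn1 : (1 : ℝ) ≤ n := by linarith
  have hn0 : 0 < n := by exact_mod_cast (zero_lt_one.trans_le hn1)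
  have hm1 : (1 : ℝ) ≤ m := by linarith [one_le_mul_of_one_le_of_one_le hz1 hn1]
  have hm0 : 0 < m := by exact_mod_cast (zero_lt_one.trans_le hm1)
  have hU0 : 0 < U := by rw [hU]; positivity
  have hε₁0 : 0 < ε₁ := by rw [hε₁]; positivity
  have hUm : U = m * ε₁ := by rw [hε₁]; field_simp
  have hsqrt : Real.sqrt ((n ^ 2 : ℕ) : ℝ) = n := by
    rw [Nat.cast_pow, Real.sqrt_sq (by positivity)]
  rw [hsqrt]
  -- everything of interest is polynomial in `X`
  set s : ℝ := Fintype.card S * Fintype.card A with hs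
  have hs1 : 1 ≤ s := by
    have h1 : (1 : ℝ) ≤ Fintype.card S := by exact_mod_cast Fintype.card_pos
    have h2 : (1 : ℝ) ≤ Fintype.card A := by exact_mod_cast Fintype.card_pos
    exact one_le_mul_of_one_le_of_one_le h1 h2
  set w := 1 / (ε * a ^ 2) with hw
  have hwa : 1 / a ≤ w := by
    rw [hw]
    refine one_div_le_one_div_of_le (by positivity) ?_
    calc ε * a ^ 2 = ε * a * a := by ring
      _ ≤ a := mul_le_of_le_one_left ha0.le hεa
  have h1a : 1 ≤ 1 / a := by rwa [le_div_iff₀ ha0, one_mul]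
  have hw1 : 1 ≤ w := h1a.trans hwa
  set X : ℝ := d * Fintype.card S * Fintype.card A / (ε * a ^ 2) with hX
  have hXeq : X = d * s * w := by rw [hX, hs, hw]; ring
  have hdw : d * w ≤ X := by
    rw [hXeq]
    calc d * w = d * 1 * w := by ring
      _ ≤ d * s * w := by gcongr
  have hwX : w ≤ X := (le_mul_of_one_le_left (by positivity) hd').trans hdw
  have hdX : (d : ℝ) ≤ X := (le_mul_of_one_le_right (by positivity) hw1).trans hdw
  have hsX : s ≤ X := by
    rw [hXeq]
    calc s = 1 * s * 1 := by ring
      _ ≤ d * s * w := by gcongr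
  have hX1 : 1 ≤ X := hw1.trans hwX
  have hzX : z ≤ X ^ 2 := by
    have h1 : z = d * (w * a) ^ 2 := by rw [hz, hw]; field_simp
    have h2 : w * a ≤ w := mul_le_of_le_one_right (by positivity) ha1
    calc z = d * (w * a) ^ 2 := h1
      _ ≤ d * d * w ^ 2 := by
          gcongr
          exact le_mul_of_one_le_left (by positivity) hd'
      _ = (d * w) ^ 2 := by ring
      _ ≤ X ^ 2 := by gcongr
  have hmX : (m : ℝ) + 1 ≤ 1618 * X ^ 4 := by
    have h1 : z ^ 2 ≤ (X ^ 2) ^ 2 := pow_le_pow_left₀ (by positivity) hzX 2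
    have h2 : 1 ≤ X ^ 4 := one_le_pow₀ hX1
    have h3 : (X ^ 2) ^ 2 = X ^ 4 := by ring
    linarith
  set L := 1 + Real.log X with hL
  set ℓ := 30 * (d * L * Real.log (1 / δ)) with hℓ
  have hL1 : 1 ≤ L := by linarith [Real.log_nonneg hX1]
  have hℓ0 : 0 < ℓ := by positivity
  have hN0' : (0 : ℝ) < N := lt_of_lt_of_le (by positivity) hN
  have hN0 : 0 < N := by exact_mod_cast hN0'
  set ω := ε * a / 8 with hω
  have hω0 : 0 < ω := by positivity
  set Y : ℝ := (1618 * X ^ 4) ^ d with hY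
  have hmY : ((m : ℝ) + 1) ^ d ≤ Y := pow_le_pow_left₀ (by positivity) hmX d
  have hY1 : 1 ≤ Y := one_le_pow₀ (by linarith [one_le_pow₀ (n := 4) hX1])
  set ι := δ * a * ω / (s * Y) with hι
  have hι0 : 0 < ι := by positivity
  set B := 1 + ω + d * U with hB
  obtain ⟨π₀, hπ₀, hopt⟩ := M.exists_isFeasible_optimalValue_lt hfeas
    (x := M.optimalValue - ε / 4) (by linarith)
  obtain ⟨E, hE, hprob, hEacc⟩ := exists_accurateData_event (N := N) M hπ₀.1 (ι := ι) (B := B)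
    (ε₁ := ε₁) (ℓ := ℓ) (Λ := dualNet ε₁ U) hε0 hε1 hω0 hι0 hε₁0.le (m := m) (by rw [hB, hUm])
    (fun x hx => exists_nat_mul_of_mem_dualNet hε₁0 hUm hx) hN0 hδ0.le
    (by
      rw [div_le_iff₀ (by positivity)] at hN ⊢
      rw [← ha]
      linarith)
    (by
      rw [← ha, ← hs]
      have h1 : s * (m + 1 : ℝ) ^ d * (ι / a / ω) = δ * ((m + 1 : ℝ) ^ d / Y) := by
        rw [hι]; field_simp
      rw [h1]
      exact mul_le_of_le_one_right hδ0.le (div_le_one_of_le₀ hmY (by positivity)))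
    (by
      rw [← ha, ← hs]
      refine union_budget (X := X) (Y := Y) (a := a) (ε := ε) (b := B) hX1 hY1 hδ0 hδ1 (by linarith)
        hsX (by positivity) hmY (by positivity) hdX ha0 hε0 ?_ ?_ ?_ ?_
        (le_exp_budget hX1 hd hδ0 hδ)
      · have h1 : 1 / (ε * a ^ 3) = w * (1 / a) := by rw [hw]; field_simp
        rw [h1, sq]
        exact mul_le_mul hwX (hwa.trans hwX) (by positivity) (by linarith)
      · have h1 : d * U = 4 * (d * (w * a)) := by rw [hU, hw]; field_simp
        have h2 : w * a ≤ w := mul_le_of_le_one_right (by positivity) ha1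
        have h3 : d * (w * a) ≤ d * w := by gcongr
        rw [hB, h1]
        linarith
      · exact Nat.floor_le (by positivity)
      · refine (Nat.floor_le (by positivity)).trans ?_
        have h1 : 1 / a / (ε * a / 256) = 256 * w := by rw [hw]; field_simp
        rw [h1]
        linarith)
  refine ⟨E, hE, hprob, fun D hD => ⟨M.exists_isRun hN0 D _ hε₁0 _ _, fun lam pol hrun => ?_⟩⟩
  have hres := hrun.mixtureValue_ge hN0 hε0 hε1 hU hε₁0 (by positivity) (by positivity) hπ₀
    (regret_budget ha0 hε0 hd hU hn hm hn0 hm0 hε₁) (hEacc D hD)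
  exact ⟨by linarith [hres.1], hres.2⟩

end

theorem theorem3 :
    ∃ (C : ℝ) (k : ℕ),
      ∀ (d : ℕ) (γ ε : ℝ), 1 ≤ d → 0 ≤ γ → γ < 1 → 0 < ε → ε ≤ 1 / (1 - γ) →
      -- the parameters depend on `d`, `γ`, `ε` only
      ∃ (U ε₁ : ℝ) (T : ℕ),
        (0 < U ∧ U ≤ C * (1 / (ε * (1 - γ)))) ∧
        (0 < ε₁ ∧ ε₁ ≤ C * (ε ^ 2 * (1 - γ) ^ 2)) ∧
        (0 < T ∧ (T : ℝ) ≤ C * ((d : ℝ) ^ 2 / ((1 - γ) ^ 4 * ε ^ 4))) ∧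
        ∀ (δ : ℝ), 0 < δ → δ < 1 →
        ∀ (S : Type u) (A : Type v) [Fintype S] [Nonempty S] [MeasurableSpace S]
          [DiscreteMeasurableSpace S] [Fintype A] [Nonempty A],
        -- the number of samples per state-action pair, up to a polylogarithmic factor
        ∃ N₀ : ℕ,
          (N₀ : ℝ) ≤
            C * (1 + Real.log (d * Fintype.card S * Fintype.card A / (ε * (1 - γ) ^ 2))) ^ k *
              (d * Real.log (1 / δ) / ((1 - γ) ^ 3 * ε ^ 2)) ∧
          -- the total number of samples
          (Fintype.card (S × A × Fin N₀) : ℝ) ≤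
            C * (1 + Real.log (d * Fintype.card S * Fintype.card A / (ε * (1 - γ) ^ 2))) ^ k *
              (d * Fintype.card S * Fintype.card A * Real.log (1 / δ) /
                ((1 - γ) ^ 3 * ε ^ 2)) ∧
          ∀ (N : ℕ), N₀ ≤ N →
          ∀ (M : CMDP S A d), M.γ = γ → (∃ π, M.IsFeasible π) →
          ∃ E : Set (Data S A N), MeasurableSet E ∧
            ENNReal.ofReal (1 - 3 * δ) ≤ M.dataLaw N (ε * (1 - γ) / 8) E ∧
            ∀ D ∈ E,
              (∃ (lam : ℕ → Fin d → ℝ) (pol : ℕ → S → A → ℝ),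
                M.IsRun D (fun i => M.b i - 3 * ε / 8) U ε₁ (U * (1 - γ) / Real.sqrt T) T
                  lam pol) ∧
              ∀ (lam : ℕ → Fin d → ℝ) (pol : ℕ → S → A → ℝ),
                M.IsRun D (fun i => M.b i - 3 * ε / 8) U ε₁ (U * (1 - γ) / Real.sqrt T) T
                  lam pol →
                M.optimalValue - ε ≤ M.mixtureValue M.r T pol ∧
                ∀ i, M.b i - ε ≤ M.mixtureValue (M.c i) T pol := by
  refine ⟨10 ^ 6, 1, fun d γ ε hd hγ0 hγ1 hε0 hε1 => ?_⟩
  have hd' : (1 : ℝ) ≤ d := by exact_mod_cast hd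
  have h1γ : 0 < 1 - γ := by linarith
  set a := 1 - γ with ha
  have ha1 : a ≤ 1 := by linarith
  have hεa : ε * a ≤ 1 := by rwa [le_div_iff₀ h1γ] at hε1
  set z := (d : ℝ) / (ε ^ 2 * a ^ 2) with hz
  have hz1 : 1 ≤ z := by
    rw [hz, le_div_iff₀ (by positivity), one_mul, ← mul_pow]
    exact (pow_le_one₀ (by positivity) hεa).trans hd'
  set n := ⌈32 * z⌉₊ with hn
  have hn1 : 32 * z ≤ n := Nat.le_ceil _
  have hn2 : (n : ℝ) ≤ 33 * z := by linarith [Nat.ceil_lt_add_one (show 0 ≤ 32 * z by positivity)]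
  have hn0 : (0 : ℝ) < n := by linarith
  set m := ⌈48 * z * n⌉₊ with hm
  have hm1 : 48 * z * n ≤ m := Nat.le_ceil _
  have hzn : 1 ≤ z * n := one_le_mul_of_one_le_of_one_le hz1 (by linarith)
  have hm2 : (m : ℝ) ≤ 1617 * z ^ 2 := by
    have h1 := Nat.ceil_lt_add_one (show 0 ≤ 48 * z * n by positivity)
    have h2 : z * n ≤ z * (33 * z) := by gcongr
    linarith
  have hm0 : (0 : ℝ) < m := by linarith
  refine ⟨4 / (ε * a), 4 / (ε * a) / m, n ^ 2, ⟨by positivity, ?_⟩, ⟨by positivity, ?_⟩,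
    ⟨pow_pos (by exact_mod_cast hn0) 2, ?_⟩, fun δ hδ0 hδ1 S A _ _ _ _ _ _ => ?_⟩
  · rw [mul_one_div]
    gcongr
    norm_num
  · rw [div_le_iff₀ hm0, div_le_iff₀ (by positivity)]
    have h1 : 1 ≤ ε ^ 4 * a ^ 4 * (z * z) := by
      have h2 : ε ^ 4 * a ^ 4 * (z * z) = d * d := by rw [hz]; field_simp
      rw [h2]
      exact one_le_mul_of_one_le_of_one_le hd' hd'
    have h3 : ε ^ 4 * a ^ 4 * (z * z) ≤ ε ^ 3 * a ^ 3 * (z * z) := by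
      have h4 : ε ^ 4 * a ^ 4 * (z * z) = ε * a * (ε ^ 3 * a ^ 3 * (z * z)) := by ring
      rw [h4]
      exact mul_le_of_le_one_left (by positivity) hεa
    have h5 : z * z ≤ m := by
      have h6 : z * z ≤ z * n := by gcongr; linarith
      linarith
    have h7 : ε ^ 3 * a ^ 3 * (z * z) ≤ ε ^ 3 * a ^ 3 * m := by gcongr
    linarith
  · push_cast
    have h1 : (d : ℝ) ^ 2 / (a ^ 4 * ε ^ 4) = z ^ 2 := by rw [hz]; field_simp
    rw [h1]
    have h2 : (n : ℝ) ^ 2 ≤ (33 * z) ^ 2 := by gcongr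
    linarith [sq_nonneg z]
  have hS : (1 : ℝ) ≤ Fintype.card S := by exact_mod_cast Fintype.card_pos
  have hA : (1 : ℝ) ≤ Fintype.card A := by exact_mod_cast Fintype.card_pos
  have hlogδ : 0 ≤ Real.log (1 / δ) := Real.log_nonneg (by rw [le_div_iff₀ hδ0]; linarith)
  set L := 1 + Real.log (d * Fintype.card S * Fintype.card A / (ε * a ^ 2)) with hL
  have hL1 : 1 ≤ L := by
    have h1 : ε * a ^ 2 ≤ 1 := by
      calc ε * a ^ 2 = ε * a * a := by ring
        _ ≤ 1 * 1 := mul_le_mul hεa ha1 h1γ.le zero_le_one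
        _ = 1 := one_mul 1
    have h2 : (1 : ℝ) ≤ d * Fintype.card S * Fintype.card A :=
      one_le_mul_of_one_le_of_one_le (one_le_mul_of_one_le_of_one_le hd' hS) hA
    have := Real.log_nonneg ((one_le_div (by positivity)).2 (h1.trans h2))
    linarith
  have hL0 : 0 < L := by linarith
  -- the bound on the total number of samples is the bound per pair, times the number of pairs
  suffices h : ∃ N₀ : ℕ, (N₀ : ℝ) ≤ 10 ^ 6 * L ^ 1 * (d * Real.log (1 / δ) / (a ^ 3 * ε ^ 2)) ∧
      ∀ (N : ℕ), N₀ ≤ N → ∀ (M : CMDP S A d), M.γ = γ → (∃ π, M.IsFeasible π) →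
      ∃ E : Set (Data S A N), MeasurableSet E ∧
        ENNReal.ofReal (1 - 3 * δ) ≤ M.dataLaw N (ε * a / 8) E ∧
        ∀ D ∈ E,
          (∃ (lam : ℕ → Fin d → ℝ) (pol : ℕ → S → A → ℝ),
            M.IsRun D (fun i => M.b i - 3 * ε / 8) (4 / (ε * a)) (4 / (ε * a) / m)
              (4 / (ε * a) * a / Real.sqrt ((n ^ 2 : ℕ) : ℝ)) (n ^ 2) lam pol) ∧
          ∀ (lam : ℕ → Fin d → ℝ) (pol : ℕ → S → A → ℝ),
            M.IsRun D (fun i => M.b i - 3 * ε / 8) (4 / (ε * a)) (4 / (ε * a) / m)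
              (4 / (ε * a) * a / Real.sqrt ((n ^ 2 : ℕ) : ℝ)) (n ^ 2) lam pol →
            M.optimalValue - ε ≤ M.mixtureValue M.r (n ^ 2) pol ∧
            ∀ i, M.b i - ε ≤ M.mixtureValue (M.c i) (n ^ 2) pol by
    obtain ⟨N₀, hN₀, hmain⟩ := h
    refine ⟨N₀, hN₀, ?_, hmain⟩
    simp only [Fintype.card_prod, Fintype.card_fin]
    push_cast
    calc (Fintype.card S : ℝ) * (Fintype.card A * N₀)
        ≤ Fintype.card S * (Fintype.card A *
          (10 ^ 6 * L ^ 1 * (d * Real.log (1 / δ) / (a ^ 3 * ε ^ 2)))) := by gcongr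
      _ = _ := by ring
  rcases le_or_gt 1 (3 * δ) with hδ | hδ
  · -- the claimed probability is not positive
    exact ⟨0, by rw [Nat.cast_zero]; positivity, fun N _ M _ _ =>
      ⟨∅, .empty, by rw [ENNReal.ofReal_of_nonpos (by linarith)]; exact zero_le, by simp⟩⟩
  · have hδlog : 1 ≤ Real.log (1 / δ) := by
      rw [Real.le_log_iff_exp_le (by positivity), le_div_iff₀ hδ0]
      have := Real.exp_one_lt_d9
      nlinarith
    refine ⟨⌈8192 * (30 * (d * L * Real.log (1 / δ))) / (a ^ 3 * ε ^ 2)⌉₊, ?_,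
      fun N hN M hM hfeas => exists_event_of_le_samples hd hγ1 hγ0 hε0 hε1 rfl hn1 hm1 hm2 rfl
        hδ0 hδ1 hδlog (Nat.ceil_le.1 hN) M hM hfeas⟩
    set q := L * (d * Real.log (1 / δ) / (a ^ 3 * ε ^ 2)) with hq
    have hq1 : 1 ≤ q := by
      refine one_le_mul_of_one_le_of_one_le hL1 ?_
      rw [le_div_iff₀ (by positivity), one_mul]
      calc a ^ 3 * ε ^ 2 = a * (ε * a) ^ 2 := by ring
        _ ≤ 1 * 1 := mul_le_mul ha1 (pow_le_one₀ (by positivity) hεa) (by positivity) zero_le_one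
        _ ≤ d * Real.log (1 / δ) := mul_le_mul hd' hδlog zero_le_one (by positivity)
    have h1 : 8192 * (30 * (d * L * Real.log (1 / δ))) / (a ^ 3 * ε ^ 2) = 245760 * q := by
      rw [hq]; ring
    have h2 : 10 ^ 6 * L ^ 1 * (d * Real.log (1 / δ) / (a ^ 3 * ε ^ 2)) = 10 ^ 6 * q := by
      rw [hq]; ring
    rw [h1, h2]
    linarith [Nat.ceil_lt_add_one (show 0 ≤ 245760 * q by positivity)]
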